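/- Let $r\ge 3$ be an odd integer and $q=e^{2\pi i/r}$. Put $\{n\}=q^n-q^{-n}$, $\{n\}!=\prod_{i=1}^n\{i\}$ (with $\{0\}!=1$) and $\zeta_r=2\sin(2\pi/r)$. A triple $(a,b,c)$ of non-negative integers is called $r$-admissible if $a,b,c\le r-2$, $a+b+c$ is even and at most $2r-4$, and $a\le b+c$, $b\le a+c$, $c\le a+b$. A $6$-tuple $(n_1,\dots,n_6)$ is called $r$-admissible if the four triples $v_1=(n_1,n_2,n_3)$, $v_2=(n_1,n_5,n_6)$, $v_3=(n_2,n_4,n_6)$, $v_4=(n_3,n_4,n_5)$ are $r$-admissible. For an $r$-admissible triple let $$\Delta(a,b,c)=\left(\sqrt{-1}\,\zeta_r\,\frac{\{\frac{a+b-c}{2}\}!\,\{\frac{a-b+c}{2}\}!\,\{\frac{-a+b+c}{2}\}!}{\{\frac{a+b+c}{2}+1\}!}\right)^{1/2},$$ where the radicand is real and the root is the positive one if it is positive and the one with positive imaginary part if it is negative. The quantum $6j$-symbol of an $r$-admissible $6$-tuple, at $q=e^{2\pi i/r}$, is $$\begin{vmatrix} n_1&n_2&n_3\\ n_4&n_5&n_6\end{vmatrix}=\zeta_r^{-1}(\sqrt{-1})^{\sum_{i=1}^6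 n_i}\prod_{i=1}^4\Delta(v_i)\sum_{z=\max T_i}^{\min Q_j}\frac{(-1)^z\{z+1\}!}{\prod_{i=1}^4\{z-T_i\}!\,\prod_{j=1}^3\{Q_j-z\}!},$$ where $T_i$ is half the sum of the entries of $v_i$, and $Q_1=\frac{n_1+n_2+n_4+n_5}{2}$, $Q_2=\frac{n_1+n_3+n_4+n_6}{2}$, $Q_3=\frac{n_2+n_3+n_5+n_6}{2}$. Let $v_8\approx 3.66$ be the volume of the regular ideal octahedron in hyperbolic $3$-space. **Theorem.** There is a constant $C$ such that for every odd integer $r\ge 3$ and every $r$-admissible $6$-tuple $(n_1,\dots,n_6)$, $$\frac{2\pi}{r}\log\left|\begin{vmatrix} n_1&n_2&n_3\\ n_4&n_5&n_6\end{vmatrix}_{q=e^{2\pi i/r}}\right|\le v_8+C\,\frac{\log r}{r}$$ (the inequality being trivially true when the symbol vanishes). -/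

import Mathlib

namespace Quantum6j

/-- The root of unity `q = e^{2πi/r}`. -/
noncomputable def rootQ (r : ℕ) : ℂ :=
  Complex.exp (2 * (Real.pi : ℂ) * Complex.I / (r : ℂ))

/-- The quantum integer `{n} = q^n - q^{-n}`. -/
noncomputable def qInt (q : ℂ) (n : ℕ) : ℂ := q ^ n - (q ^ n)⁻¹

/-- The quantum factorial `{n}! = {1}{2}⋯{n}`. -/
noncomputable def qFact (q : ℂ) (n : ℕ) : ℂ := ∏ i ∈ Finset.Icc 1 n, qInt q i

/-- `r`-admissible triples; the bounds `a ≤ r - 2` and `a + b + c ≤ 2 r - 4` are written without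
subtraction. -/
structure AdmissibleTriple (r a b c : ℕ) : Prop where
  a_le : a + 2 ≤ r
  b_le : b + 2 ≤ r
  c_le : c + 2 ≤ r
  even_sum : Even (a + b + c)
  sum_le : a + b + c + 4 ≤ 2 * r
  tri_a : a ≤ b + c
  tri_b : b ≤ a + c
  tri_c : c ≤ a + b

/-- `r`-admissible 6-tuples. -/
structure Admissible (r n₁ n₂ n₃ n₄ n₅ n₆ : ℕ) : Prop where
  triple₁ : AdmissibleTriple r n₁ n₂ n₃
  triple₂ : AdmissibleTriple r n₁ n₅ n₆
  triple₃ : AdmissibleTriple r n₂ n₄ n₆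
  triple₄ : AdmissibleTriple r n₃ n₄ n₅

/-- The real number `ζ_r = 2 sin(2π/r)`. -/
noncomputable def zeta (r : ℕ) : ℝ := 2 * Real.sin (2 * Real.pi / r)

/-- The factor `Δ(a,b,c)` at `q = e^{2πi/r}`. For an admissible triple the divisions by two are
exact, the differences are nonnegative, and the radicand is a real number; the principal power
`x ^ (1/2)` is then the nonnegative root for `x ≥ 0` and the root with positive imaginary part
for `x < 0`. -/
noncomputable def Delta (r a b c : ℕ) : ℂ :=
  (Complex.I * (zeta r : ℂ) *
    (qFact (rootQ r) ((a + b - c) / 2) * qFact (rootQ r) ((a + c - b) / 2) *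
      qFact (rootQ r) ((b + c - a) / 2)) /
    qFact (rootQ r) ((a + b + c) / 2 + 1)) ^ (1 / 2 : ℂ)

/-- The quantum 6j-symbol with rows `n₁ n₂ n₃` and `n₄ n₅ n₆`, at `q = e^{2πi/r}`. -/
noncomputable def sixJ (r n₁ n₂ n₃ n₄ n₅ n₆ : ℕ) : ℂ :=
  let q := rootQ r
  let T₁ := (n₁ + n₂ + n₃) / 2
  let T₂ := (n₁ + n₅ + n₆) / 2
  let T₃ := (n₂ + n₄ + n₆) / 2
  let T₄ := (n₃ + n₄ + n₅) / 2
  let Q₁ := (n₁ + n₂ + n₄ + n₅) / 2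
  let Q₂ := (n₁ + n₃ + n₄ + n₆) / 2
  let Q₃ := (n₂ + n₃ + n₅ + n₆) / 2
  (zeta r : ℂ)⁻¹ * Complex.I ^ (n₁ + n₂ + n₃ + n₄ + n₅ + n₆) *
    (Delta r n₁ n₂ n₃ * Delta r n₁ n₅ n₆ * Delta r n₂ n₄ n₆ * Delta r n₃ n₄ n₅) *
    ∑ z ∈ Finset.Icc (max (max T₁ T₂) (max T₃ T₄)) (min Q₁ (min Q₂ Q₃)),
      (-1 : ℂ) ^ z * qFact q (z + 1) /
        ((qFact q (z - T₁) * qFact q (z - T₂) * qFact q (z - T₃) * qFact q (z - T₄)) *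
          (qFact q (Q₁ - z) * qFact q (Q₂ - z) * qFact q (Q₃ - z)))

/-- The volume measure of hyperbolic 3-space (curvature `-1`) in the projective (Klein) model: on
the open unit ball of Euclidean 3-space it has density `(1 - |x|²)⁻²`. Geodesic lines and planes
of this model are Euclidean lines and planes, and ideal points are the points of the unit
sphere. -/
noncomputable def hyperbolicVolume : MeasureTheory.Measure (EuclideanSpace ℝ (Fin 3)) :=
  (MeasureTheory.volume.restrict (Metric.ball (0 : EuclideanSpace ℝ (Fin 3)) 1)).withDensity
    (fun x => ENNReal.ofReal (((1 - ‖x‖ ^ 2) ^ 2)⁻¹))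

/-- The regular ideal octahedron in the Klein model: the hull of the six ideal points `±e₁`,
`±e₂`, `±e₃`. (The ideal vertices themselves lie off the open ball.) -/
noncomputable def idealOctahedron : Set (EuclideanSpace ℝ (Fin 3)) :=
  convexHull ℝ (Set.range (fun i : Fin 3 => EuclideanSpace.single i (1 : ℝ)) ∪
    Set.range (fun i : Fin 3 => EuclideanSpace.single i (-1 : ℝ)))

/-- `v₈`, the volume of the regular ideal hyperbolic octahedron. -/
noncomputable def v8 : ℝ := (hyperbolicVolume idealOctahedron).toReal

end Quantum6j

/-! Write Λ for the Lobachevsky function `lob` and d = 2π/r. Since |{n}| = |2 sin(nd)|, log |{n}!|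
is a Riemann sum, equal to -Λ(nd)/d up to O(log r) for every n < r (`abs_logQFact_add_lob_le`). The
sum over z has O(r) terms, and those with z + 1 ≥ r vanish, so it suffices to bound each remaining
term together with its prefactor.

For such a z put x_i = (z - T_i)d, y_j = (Q_j - z)d for j ≤ 3, and y_4 = (r - z)d. These eight
numbers are nonnegative with sum 2π. Because Λ is odd and π-periodic, the leading exponent is 1/d
times Σ Λ(x_i) + Σ Λ(y_j) - ½ ΣΣ Λ(x_i + y_j). The analytic heart is `lobSum_le`: this is at most
8Λ(π/4), with equality when all eight numbers are π/4.

To prove it, distribute the expression over the 16 pairs (i, j). By midpoint concavity each pair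
depends only on s = x_i + y_j, and 2Λ(s/2) - 2Λ(s) lies below its tangent line at π/2; summing the
tangents gives the bound. The tangent inequality fails for s near 0, so a configuration having a
pair with s ≤ 0.62 is estimated separately, with room to spare.

Finally 8Λ(π/4) is the octahedral volume (`v8_eq`): in the Klein model, integrate along the cone
from an ideal vertex, then in polar coordinates on the equatorial square. -/

open Real MeasureTheory Set intervalIntegral
open scoped ENNReal

/-! ### The Lobachevsky function: symmetries and midpoint concavity -/

/-- The Lobachevsky function. -/
noncomputable def lob (x : ℝ) : ℝ := -∫ t in (0 : ℝ)..x, log (2 * sin t)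

/-- The real `log` sees only absolute values, so the integrand is log |2 sin t|; its singularities
at multiples of π are logarithmic, as for any meromorphic function. -/
theorem intervalIntegrable_log_two_mul_sin (a b : ℝ) :
    IntervalIntegrable (fun t => log (2 * sin t)) volume a b := by
  have h : MeromorphicOn (fun t : ℝ => 2 * sin t) (uIcc a b) := by
    intro x _
    exact (AnalyticAt.meromorphicAt (by fun_prop))
  simpa only [norm_eq_abs, log_abs] using h.intervalIntegrable_log_norm

theorem lob_zero : lob 0 = 0 := by simp [lob]

theorem continuous_lob : Continuous lob :=
  (continuous_primitive intervalIntegrable_log_two_mul_sin 0).neg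

theorem hasDerivAt_lob {x : ℝ} (hx : sin x ≠ 0) :
    HasDerivAt lob (-log (2 * sin x)) x := by
  refine (integral_hasDerivAt_right (intervalIntegrable_log_two_mul_sin 0 x) ?_ ?_).neg
  · exact (by fun_prop : Measurable fun t => log (2 * sin t)).stronglyMeasurable.stronglyMeasurableAtFilter
  · exact ContinuousAt.log (by fun_prop) (by simpa using hx)

theorem lob_neg (x : ℝ) : lob (-x) = -lob x := by
  have h := integral_comp_neg (fun t => log (2 * sin t)) (a := 0) (b := x)
  simp only [sin_neg, mul_neg, log_neg_eq_log, neg_zero] at h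
  rw [lob, lob, integral_symm, ← h]

theorem integral_log_two_mul_sin {a b c : ℝ} (h : ∫ t in a..b, log (sin t) = c) :
    ∫ t in a..b, log (2 * sin t) = (b - a) * log 2 + c := by
  rw [← h]
  have : ∀ᵐ t ∂(volume : Measure ℝ), t ∈ uIoc a b → log (2 * sin t) = log 2 + log (sin t) := by
    have hc : ({t : ℝ | sin t = 0}).Countable := by
      have : {t : ℝ | sin t = 0} = range (fun n : ℤ => (n : ℝ) * π) := by
        ext t; simp [sin_eq_zero_iff]
      rw [this]; exact countable_range _
    filter_upwards [hc.ae_notMem volume] with t ht _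
    exact log_mul two_ne_zero ht
  rw [intervalIntegral.integral_congr_ae this, intervalIntegral.integral_add (by simp)
    (by simpa [Function.comp_def] using intervalIntegrable_log_sin)]
  simp

theorem lob_pi : lob π = 0 := by
  rw [lob, integral_log_two_mul_sin integral_log_sin_zero_pi]; ring

theorem lob_pi_div_two : lob (π / 2) = 0 := by
  rw [lob, integral_log_two_mul_sin integral_log_sin_zero_pi_div_two]; ring

theorem lob_add_pi (x : ℝ) : lob (x + π) = lob x := by
  have h1 := integral_add_adjacent_intervals (intervalIntegrable_log_two_mul_sin 0 π)
    (intervalIntegrable_log_two_mul_sin π (x + π))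
  have h2 := integral_comp_add_right (fun t => log (2 * sin t)) π (a := 0) (b := x)
  simp only [sin_add_pi, mul_neg, log_neg_eq_log, zero_add] at h2
  have h3 := lob_pi
  unfold lob at *
  rw [← h1, ← h2]
  linarith

theorem lob_periodic : Function.Periodic lob π := lob_add_pi

theorem lob_pi_sub (x : ℝ) : lob (π - x) = -lob x := by
  rw [← lob_neg, ← lob_add_pi (-x)]; ring_nf

theorem lob_two_pi_sub (x : ℝ) : lob (2 * π - x) = -lob x := by
  rw [← lob_neg, ← lob_add_pi (-x), ← lob_add_pi (-x + π)]; ring_nf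

theorem continuousOn_lob {s : Set ℝ} : ContinuousOn lob s := continuous_lob.continuousOn

/-- The derivative of `lob` is at least -log 2. Comparing integrals rather than derivatives carries
this across the singularities. -/
theorem lob_add_mul_log_two_mono : Monotone fun x => lob x + x * log 2 := by
  intro a b hab
  have h := integral_mono_on hab (intervalIntegrable_log_two_mul_sin a b)
    (intervalIntegrable_const (c := log 2)) (fun t _ => by
      rcases eq_or_ne (sin t) 0 with h | h
      · simp [h, log_nonneg]
      · rw [← log_abs]
        apply log_le_log (by positivity)
        rw [abs_mul, abs_two]
        linarith [abs_sin_le_one t])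
  have h2 := integral_add_adjacent_intervals (intervalIntegrable_log_two_mul_sin 0 a)
    (intervalIntegrable_log_two_mul_sin a b)
  simp only [lob]
  rw [← h2]
  simp at h
  linarith

theorem lob_add_ge {x y : ℝ} (hx : 0 ≤ x) : lob y - x * log 2 ≤ lob (x + y) := by
  have := lob_add_mul_log_two_mono (show y ≤ x + y by linarith)
  simp only at this
  linarith

/-- Λ is not concave on all of [0, π], but spreading two points symmetrically about m ≤ π/2 still
lowers the sum: the derivative in t is log(sin(m - t) / sin(m + t)), and sin(m + t) - sin(m - t) = 2
cos m sin t ≥ 0. -/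
theorem lob_add_lob_le {x y : ℝ} (hx : 0 ≤ x) (hy : 0 ≤ y) (hs : x + y ≤ π) :
    lob x + lob y ≤ 2 * lob ((x + y) / 2) := by
  wlog h : x ≤ y generalizing x y
  · have := this hy hx (by linarith) (by linarith)
    rw [add_comm y x] at this; linarith
  set m := (x + y) / 2 with hm
  have key : AntitoneOn (fun t => lob (m - t) + lob (m + t)) (Icc 0 m) := by
    refine antitoneOn_of_hasDerivWithinAt_nonpos (convex_Icc _ _)
      (f' := fun t => -log (2 * sin (m - t)) * (-1) + -log (2 * sin (m + t)) * 1) ?_ ?_ ?_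
    · exact Continuous.continuousOn (by have := continuous_lob; fun_prop)
    · intro t ht
      rw [interior_Icc] at ht
      have h1 : 0 < sin (m - t) := sin_pos_of_pos_of_lt_pi (by linarith [ht.2]) (by linarith [ht.1, ht.2])
      have h2 : 0 < sin (m + t) := sin_pos_of_pos_of_lt_pi (by linarith [ht.1, ht.2]) (by linarith [ht.1, ht.2])
      refine HasDerivAt.hasDerivWithinAt (HasDerivAt.add ?_ ?_)
      · exact (hasDerivAt_lob h1.ne').comp t ((hasDerivAt_id t).const_sub m)
      · exact (hasDerivAt_lob h2.ne').comp t ((hasDerivAt_id t).const_add m)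
    · intro t ht
      rw [interior_Icc] at ht
      have h1 : 0 < sin (m - t) := sin_pos_of_pos_of_lt_pi (by linarith [ht.2]) (by linarith [ht.1, ht.2])
      have h2 : sin (m - t) ≤ sin (m + t) := by
        rw [sin_sub, sin_add]
        have : 0 ≤ cos m * sin t := mul_nonneg
          (cos_nonneg_of_mem_Icc ⟨by linarith [ht.1, ht.2, pi_pos], by linarith⟩)
          (sin_nonneg_of_nonneg_of_le_pi ht.1.le (by linarith [ht.2, pi_pos]))
        linarith
      have := log_le_log (by linarith : 0 < 2 * sin (m - t)) (by linarith : 2 * sin (m - t) ≤ 2 * sin (m + t))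
      linarith
  have := key (left_mem_Icc.2 (by linarith)) (show m - x ∈ Icc 0 m from ⟨by linarith, by linarith⟩)
    (by linarith)
  simp only [sub_zero, add_zero, sub_sub_cancel] at this
  have e : m + (m - x) = y := by linarith
  rw [e] at this; linarith

/-! ### Taylor estimates and numerical values -/

theorem nonneg_of_deriv_nonneg {f f' : ℝ → ℝ} (h0 : f 0 = 0) (hd : ∀ x, HasDerivAt f (f' x) x)
    (h' : ∀ x, 0 ≤ x → 0 ≤ f' x) {x : ℝ} (hx : 0 ≤ x) : 0 ≤ f x := by
  have : MonotoneOn f (Ici 0) := by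
    refine monotoneOn_of_hasDerivWithinAt_nonneg (convex_Ici 0)
      (fun y _ => (hd y).continuousAt.continuousWithinAt)
      (fun y _ => (hd y).hasDerivWithinAt) (fun y hy => ?_)
    rw [interior_Ici] at hy
    exact h' y hy.le
  simpa [h0] using this self_mem_Ici hx hx

theorem sub_cube_div_six_le_sin {x : ℝ} (hx : 0 ≤ x) : x - x ^ 3 / 6 ≤ sin x := by
  have := nonneg_of_deriv_nonneg (f := fun x => sin x - (x - x ^ 3 / 6))
    (f' := fun x => cos x - (1 - x ^ 2 / 2)) (by simp) (fun x => by
      refine ((hasDerivAt_sin x).sub ((hasDerivAt_id x).sub ((hasDerivAt_pow 3 x).div_const 6))).congr_deriv ?_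
      push_cast; ring) (fun x _ => by linarith [one_sub_sq_div_two_le_cos (x := x)]) hx
  linarith

theorem cos_le_quartic {x : ℝ} (hx : 0 ≤ x) : cos x ≤ 1 - x ^ 2 / 2 + x ^ 4 / 24 := by
  have := nonneg_of_deriv_nonneg (f := fun x => (1 - x ^ 2 / 2 + x ^ 4 / 24) - cos x)
    (f' := fun x => sin x - (x - x ^ 3 / 6)) (by simp) (fun x => by
      refine ((((hasDerivAt_const x 1).sub ((hasDerivAt_pow 2 x).div_const 2)).add
        ((hasDerivAt_pow 4 x).div_const 24)).sub (hasDerivAt_cos x)).congr_deriv ?_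
      push_cast; ring) (fun x hx => by linarith [sub_cube_div_six_le_sin hx]) hx
  linarith

theorem sin_le_quintic {x : ℝ} (hx : 0 ≤ x) : sin x ≤ x - x ^ 3 / 6 + x ^ 5 / 120 := by
  have := nonneg_of_deriv_nonneg (f := fun x => (x - x ^ 3 / 6 + x ^ 5 / 120) - sin x)
    (f' := fun x => (1 - x ^ 2 / 2 + x ^ 4 / 24) - cos x) (by simp) (fun x => by
      refine ((((hasDerivAt_id x).sub ((hasDerivAt_pow 3 x).div_const 6)).add
        ((hasDerivAt_pow 5 x).div_const 120)).sub (hasDerivAt_sin x)).congr_deriv ?_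
      push_cast; ring) (fun x hx => by linarith [cos_le_quartic hx]) hx
  linarith

theorem log_sin_le {t : ℝ} (h0 : 0 < t) (h1 : t ≤ 1) : log (2 * sin t) ≤ log (2 * t) - t ^ 2 / 6 := by
  have hs : 0 < sin t := sin_pos_of_pos_of_lt_pi h0 (by linarith [pi_gt_three])
  have key : sin t * exp (t ^ 2 / 6) ≤ t := by
    have ht2 : t ^ 2 ≤ 1 := by nlinarith
    have e := exp_bound' (x := t ^ 2 / 6) (by positivity) (by linarith) (n := 3) (by norm_num)
    simp [Finset.sum_range_succ, Nat.factorial] at e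
    have hsin := sin_le_quintic h0.le
    calc sin t * exp (t ^ 2 / 6) ≤ (t - t ^ 3 / 6 + t ^ 5 / 120) * _ :=
          mul_le_mul hsin e (exp_pos _).le (hs.le.trans hsin)
      _ ≤ t := by
          obtain ⟨u, hu⟩ : ∃ u, u = t ^ 2 := ⟨_, rfl⟩
          have hu0 : 0 ≤ u := hu ▸ sq_nonneg t
          have e1 : t - t ^ 3 / 6 + t ^ 5 / 120 = t * (1 - u / 6 + u ^ 2 / 120) := by rw [hu]; ring
          rw [e1, mul_assoc, ← hu]
          refine mul_le_of_le_one_right h0.le ?_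
          rw [← hu] at ht2
          nlinarith [mul_nonneg hu0 hu0, mul_nonneg (mul_nonneg hu0 hu0) (sub_nonneg.2 ht2),
            pow_nonneg hu0 3, pow_nonneg hu0 4, mul_nonneg (pow_nonneg hu0 3) (sub_nonneg.2 ht2),
            mul_nonneg (pow_nonneg hu0 4) (sub_nonneg.2 ht2)]
  have := log_le_log (by positivity) key
  rw [log_mul hs.ne' (exp_pos _).ne', log_exp] at this
  rw [log_mul two_ne_zero hs.ne', log_mul two_ne_zero h0.ne']
  linarith

theorem le_log_sin {t : ℝ} (h0 : 0 < t) (h1 : t ≤ 1) :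
    log (2 * t) - t ^ 2 / 6 - t ^ 4 / 60 ≤ log (2 * sin t) := by
  have hs : 0 < sin t := sin_pos_of_pos_of_lt_pi h0 (by linarith [pi_gt_three])
  have key : t ≤ sin t * exp (t ^ 2 / 6 + t ^ 4 / 60) := by
    have ht2 : t ^ 2 ≤ 1 := by nlinarith
    have e := quadratic_le_exp_of_nonneg (x := t ^ 2 / 6 + t ^ 4 / 60) (by positivity)
    have hsin := sub_cube_div_six_le_sin h0.le
    refine le_trans ?_ (mul_le_mul hsin e (by positivity) hs.le)
    obtain ⟨u, hu⟩ : ∃ u, u = t ^ 2 := ⟨_, rfl⟩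
    have hu0 : 0 ≤ u := hu ▸ sq_nonneg t
    have e1 : t - t ^ 3 / 6 = t * (1 - u / 6) := by rw [hu]; ring
    have e2 : t ^ 4 = u ^ 2 := by rw [hu]; ring
    rw [e1, mul_assoc, e2, ← hu]
    refine le_mul_of_one_le_right h0.le ?_
    rw [← hu] at ht2
    nlinarith [mul_nonneg hu0 hu0, mul_nonneg (mul_nonneg hu0 hu0) (sub_nonneg.2 ht2),
            pow_nonneg hu0 3, pow_nonneg hu0 4, mul_nonneg (pow_nonneg hu0 3) (sub_nonneg.2 ht2),
            mul_nonneg (pow_nonneg hu0 4) (sub_nonneg.2 ht2)]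
  have := log_le_log (by positivity) key
  rw [log_mul hs.ne' (exp_pos _).ne', log_exp] at this
  rw [log_mul two_ne_zero hs.ne', log_mul two_ne_zero h0.ne']
  linarith

theorem hasDerivAt_mul_log_two_mul {x : ℝ} (hx : 0 < x) :
    HasDerivAt (fun x => x * log (2 * x)) (log (2 * x) + 1) x := by
  have h := (hasDerivAt_id x).mul (((hasDerivAt_id x).const_mul 2).log (by simpa using hx.ne'))
  refine h.congr_deriv ?_
  have := hx.ne'
  simp
  field_simp

theorem continuous_mul_log_two_mul : Continuous fun x : ℝ => x * log (2 * x) := by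
  have h : (fun x : ℝ => x * log (2 * x)) = fun x => (2 * x * log (2 * x)) / 2 := by
    ext x; ring
  rw [h]
  exact (continuous_mul_log.comp (by fun_prop : Continuous fun x : ℝ => 2 * x)).div_const 2

/-- Integrates `log_sin_le` from 0; the term x - x log(2x) comes from the singular part log(2t). -/
theorem le_lob {x : ℝ} (h0 : 0 ≤ x) (h1 : x ≤ 1) :
    x - x * log (2 * x) + x ^ 3 / 18 ≤ lob x := by
  have : MonotoneOn (fun x => lob x - (x - x * log (2 * x) + x ^ 3 / 18)) (Icc 0 1) := by
    refine monotoneOn_of_hasDerivWithinAt_nonneg (convex_Icc _ _)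
      (f' := fun x => -log (2 * sin x) - (1 - (log (2 * x) + 1) + (3 * x ^ 2) / 18)) ?_ ?_ ?_
    · have := continuous_lob
      have := continuous_mul_log_two_mul
      exact Continuous.continuousOn (by fun_prop)
    · intro t ht
      rw [interior_Icc] at ht
      have hs : 0 < sin t := sin_pos_of_pos_of_lt_pi ht.1 (by linarith [pi_gt_three, ht.2])
      refine (((hasDerivAt_lob hs.ne').sub (((hasDerivAt_id t).sub
        (hasDerivAt_mul_log_two_mul ht.1)).add ((hasDerivAt_pow 3 t).div_const 18))).congr_deriv
          (by simp)).hasDerivWithinAt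
    · intro t ht
      rw [interior_Icc] at ht
      linarith [log_sin_le ht.1 ht.2.le]
  have := this (left_mem_Icc.2 zero_le_one) ⟨h0, h1⟩ h0
  simp [lob_zero] at this
  linarith

theorem lob_le {x : ℝ} (h0 : 0 ≤ x) (h1 : x ≤ 1) :
    lob x ≤ x - x * log (2 * x) + x ^ 3 / 18 + x ^ 5 / 300 := by
  have : AntitoneOn (fun x => lob x - (x - x * log (2 * x) + x ^ 3 / 18 + x ^ 5 / 300))
      (Icc 0 1) := by
    refine antitoneOn_of_hasDerivWithinAt_nonpos (convex_Icc _ _)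
      (f' := fun x => -log (2 * sin x) -
        (1 - (log (2 * x) + 1) + (3 * x ^ 2) / 18 + (5 * x ^ 4) / 300)) ?_ ?_ ?_
    · have := continuous_lob
      have := continuous_mul_log_two_mul
      exact Continuous.continuousOn (by fun_prop)
    · intro t ht
      rw [interior_Icc] at ht
      have hs : 0 < sin t := sin_pos_of_pos_of_lt_pi ht.1 (by linarith [pi_gt_three, ht.2])
      refine (((hasDerivAt_lob hs.ne').sub ((((hasDerivAt_id t).sub
        (hasDerivAt_mul_log_two_mul ht.1)).add ((hasDerivAt_pow 3 t).div_const 18)).add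
          ((hasDerivAt_pow 5 t).div_const 300))).congr_deriv (by simp)).hasDerivWithinAt
    · intro t ht
      rw [interior_Icc] at ht
      linarith [le_log_sin ht.1 ht.2.le]
  have := this (left_mem_Icc.2 zero_le_one) ⟨h0, h1⟩ h0
  simp [lob_zero] at this
  linarith

theorem lob_pi_div_two_sub_le {x : ℝ} (h0 : 0 ≤ x) (h1 : x ≤ 1) :
    lob (π / 2 - x) ≤ x * log 2 - x ^ 3 / 6 + x ^ 5 / 120 := by
  have : AntitoneOn (fun x => lob (π / 2 - x) - (x * log 2 - x ^ 3 / 6 + x ^ 5 / 120)) (Icc 0 1) := by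
    refine antitoneOn_of_hasDerivWithinAt_nonpos (convex_Icc _ _)
      (f' := fun x => -log (2 * sin (π / 2 - x)) * (-1) - (log 2 - (3 * x ^ 2) / 6 + (5 * x ^ 4) / 120)) ?_ ?_ ?_
    · have := continuous_lob
      exact Continuous.continuousOn (by fun_prop)
    · intro t ht
      rw [interior_Icc] at ht
      have hs : 0 < sin (π / 2 - t) := by
        rw [sin_pi_div_two_sub]
        exact cos_pos_of_mem_Ioo ⟨by linarith [pi_gt_three, ht.1], by linarith [pi_gt_three, ht.2]⟩
      exact ((((hasDerivAt_lob hs.ne').comp t ((hasDerivAt_id t).const_sub _)).sub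
        ((((hasDerivAt_id t).mul_const (log 2)).sub
          ((hasDerivAt_pow 3 t).div_const 6)).add ((hasDerivAt_pow 5 t).div_const 120))).congr_deriv (by simp)).hasDerivWithinAt
    · intro t ht
      rw [interior_Icc] at ht
      have hc : 0 < cos t :=
        cos_pos_of_mem_Ioo ⟨by linarith [pi_gt_three, ht.1], by linarith [pi_gt_three, ht.2]⟩
      rw [sin_pi_div_two_sub, log_mul two_ne_zero hc.ne']
      linarith [log_le_sub_one_of_pos hc, cos_le_quartic ht.1.le]
  have := this (left_mem_Icc.2 zero_le_one) ⟨h0, h1⟩ h0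
  simp [lob_pi_div_two] at this
  linarith

theorem monotoneOn_lob : MonotoneOn lob (Icc 0 (π / 6)) := by
  refine monotoneOn_of_hasDerivWithinAt_nonneg (convex_Icc _ _)
    (f' := fun x => -log (2 * sin x)) continuousOn_lob ?_ ?_
  · intro t ht
    rw [interior_Icc] at ht
    exact (hasDerivAt_lob (sin_pos_of_pos_of_lt_pi ht.1
      (by linarith [pi_pos, ht.2])).ne').hasDerivWithinAt
  · intro t ht
    rw [interior_Icc] at ht
    have h1 := sin_pos_of_pos_of_lt_pi ht.1 (by linarith [pi_pos, ht.2])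
    have h2 := sin_le_sin_of_le_of_le_pi_div_two (x := t) (y := π / 6)
      (by linarith [pi_pos, ht.1]) (by linarith [pi_pos]) ht.2.le
    rw [sin_pi_div_six] at h2
    exact neg_nonneg.2 (log_nonpos (by positivity) (by linarith))

theorem antitoneOn_lob : AntitoneOn lob (Icc (π / 6) (π / 2)) := by
  refine antitoneOn_of_hasDerivWithinAt_nonpos (convex_Icc _ _)
    (f' := fun x => -log (2 * sin x)) continuousOn_lob ?_ ?_
  · intro t ht
    rw [interior_Icc] at ht
    exact (hasDerivAt_lob (sin_pos_of_pos_of_lt_pi (by linarith [pi_pos, ht.1])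
      (by linarith [pi_pos, ht.2])).ne').hasDerivWithinAt
  · intro t ht
    rw [interior_Icc] at ht
    have h2 := sin_le_sin_of_le_of_le_pi_div_two (x := π / 6) (y := t)
      (by linarith [pi_pos]) ht.2.le ht.1.le
    rw [sin_pi_div_six] at h2
    exact neg_nonpos.2 (log_nonneg (by linarith))

theorem lob_pi_div_six_le : lob (π / 6) ≤ 0.51 := by
  have h1 := pi_gt_d4
  have h2 := pi_lt_d4
  have h := lob_le (x := π / 6) (by positivity) (by linarith)
  have hl := one_sub_inv_le_log_of_pos (x := 2 * (π / 6)) (by positivity)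
  have hi : (2 * (π / 6))⁻¹ = 3 / π := by field_simp; norm_num
  have h3 : π / 6 * (3 / π) = 1 / 2 := by field_simp; norm_num
  have h4 : π / 6 * (1 - 3 / π) ≤ π / 6 * log (2 * (π / 6)) := by
    rw [hi] at hl
    exact mul_le_mul_of_nonneg_left hl (by positivity)
  have h5 : (π / 6) ^ 3 ≤ 0.5236 ^ 3 := by gcongr; linarith
  have h6 : (π / 6) ^ 5 ≤ 0.5236 ^ 5 := by gcongr; linarith
  norm_num at h5 h6 ⊢
  linarith

/-- The maximum is at π/6, where 2 sin = 1. This crude bound settles the pairs whose sum exceeds π,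
where midpoint concavity is unavailable. -/
theorem abs_lob_le (x : ℝ) : |lob x| ≤ 0.51 := by
  have key : ∀ y, 0 ≤ y → y ≤ π / 2 → |lob y| ≤ 0.51 := by
    intro y h0 h1
    rw [abs_of_nonneg]
    · rcases le_total y (π / 6) with h | h
      · exact (monotoneOn_lob ⟨h0, h⟩ ⟨by positivity, le_rfl⟩ h).trans lob_pi_div_six_le
      · exact (antitoneOn_lob ⟨le_rfl, by linarith [pi_pos]⟩ ⟨h, h1⟩ h).trans lob_pi_div_six_le
    · rcases le_total y (π / 6) with h | h
      · simpa [lob_zero] using monotoneOn_lob ⟨le_rfl, by positivity⟩ ⟨h0, h⟩ h0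
      · simpa [lob_pi_div_two] using antitoneOn_lob ⟨h, h1⟩ ⟨by linarith [pi_pos], le_rfl⟩ h1
  obtain ⟨y, ⟨hy0, hy1⟩, hy⟩ := lob_periodic.exists_mem_Ico₀ pi_pos x
  rw [hy]
  rcases le_total y (π / 2) with h | h
  · exact key y hy0 h
  · have := key (π - y) (by linarith) (by linarith)
    rwa [lob_pi_sub, abs_neg] at this

theorem log_le_of_le_sum {x y : ℝ} (hx : 0 < x) (hy : 0 ≤ y) (n : ℕ)
    (h : x ≤ ∑ i ∈ Finset.range n, y ^ i / i.factorial) : log x ≤ y :=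
  (log_le_iff_le_exp hx).2 (h.trans (sum_le_exp_of_nonneg hy n))

theorem le_log_of_sum_le {x y : ℝ} (hx : 0 < x) (hy : 0 ≤ y) (hy1 : y ≤ 1) {n : ℕ} (hn : 0 < n)
    (h : ∑ i ∈ Finset.range n, y ^ i / i.factorial + y ^ n * (n + 1) / (n.factorial * n) ≤ x) :
    y ≤ log x :=
  (le_log_iff_exp_le hx).2 ((exp_bound' hy hy1 hn).trans h)

theorem lob_031_le : lob 0.31 ≤ 0.46 := by
  have h := lob_le (x := 0.31) (by norm_num) (by norm_num)
  -- log 0.62 is negative, while the exponential series test needs a nonnegative bound; hence the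
  -- reciprocal.
  have hl : log (1 / (2 * 0.31)) ≤ 0.4781 :=
    log_le_of_le_sum (by norm_num) (by norm_num) 6 (by norm_num [Finset.sum_range_succ, Nat.factorial])
  rw [log_div one_ne_zero (by norm_num), log_one] at hl
  norm_num at h hl ⊢
  linarith

theorem le_lob_062 : 0.4996 ≤ lob 0.62 := by
  have h := le_lob (x := 0.62) (by norm_num) (by norm_num)
  have hl : log (2 * 0.62) ≤ 0.2152 :=
    log_le_of_le_sum (by norm_num) (by norm_num) 6 (by norm_num [Finset.sum_range_succ, Nat.factorial])
  norm_num at h hl ⊢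
  linarith

theorem le_lob_pi_div_four : 0.4575 ≤ lob (π / 4) := by
  have h1 := pi_gt_d4
  have h2 := pi_lt_d4
  have h := le_lob (x := π / 4) (by positivity) (by linarith)
  have hl : log (2 * (π / 4)) ≤ 0.4516 :=
    log_le_of_le_sum (by positivity) (by norm_num) 6 (by
      norm_num [Finset.sum_range_succ, Nat.factorial]; linarith)
  have h4 : π / 4 * log (2 * (π / 4)) ≤ π / 4 * 0.4516 := by gcongr
  have h5 : (0.785375 : ℝ) ^ 3 ≤ (π / 4) ^ 3 := by gcongr; linarith
  norm_num at h5 h4 ⊢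
  linarith

/-! ### The tangent line inequality for a pair -/

theorem two_mul_sin_eq (s : ℝ) : 2 * sin s = (2 * sin (s / 2)) * (2 * cos (s / 2)) := by
  have := sin_two_mul (s / 2)
  rw [mul_div_cancel₀ s two_ne_zero] at this
  rw [this]; ring

/-- Logarithms of the double angle factors in terms of `cos s`. -/
theorem two_mul_log_two_mul_sin_half {s : ℝ} (h0 : 0 < s) (h1 : s < π) :
    2 * log (2 * sin (s / 2)) = log (2 * (1 - cos s)) ∧
      2 * log (2 * sin s) = log (2 * (1 - cos s)) + log (2 * (1 + cos s)) := by
  have hs : 0 < sin (s / 2) := sin_pos_of_pos_of_lt_pi (by linarith) (by linarith)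
  have hc : 0 < cos (s / 2) := cos_pos_of_mem_Ioo ⟨by linarith, by linarith⟩
  have e : cos s = 2 * cos (s / 2) ^ 2 - 1 := by rw [← cos_two_mul]; ring_nf
  have e1 : 2 * (1 - cos s) = (2 * sin (s / 2)) ^ 2 := by
    rw [mul_pow, sin_sq, e]; ring
  have e2 : 2 * (1 + cos s) = (2 * cos (s / 2)) ^ 2 := by rw [e]; ring
  have e3 := two_mul_sin_eq s
  rw [e1, e2, e3, log_mul (x := 2 * sin (s / 2)) (by positivity) (by positivity), log_pow, log_pow]
  push_cast
  exact ⟨rfl, by ring⟩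

theorem hasDerivAt_lob_half {s : ℝ} (h0 : 0 < s) (h1 : s < π) :
    HasDerivAt (fun s => lob (s / 2)) (-log (2 * sin (s / 2)) / 2) s := by
  have hs : 0 < sin (s / 2) := sin_pos_of_pos_of_lt_pi (by linarith) (by linarith)
  have := (hasDerivAt_lob hs.ne').comp s ((hasDerivAt_id s).div_const 2)
  exact this.congr_deriv (by ring)

theorem hasDerivAt_lob_of_mem {s : ℝ} (h0 : 0 < s) (h1 : s < π) :
    HasDerivAt lob (-log (2 * sin s)) s :=
  hasDerivAt_lob (sin_pos_of_pos_of_lt_pi h0 h1).ne'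

/-- The gap between the tangent line at `π / 2` and `2 lob (s / 2) - 2 lob s`. -/
noncomputable def tangentGap (s : ℝ) : ℝ :=
  2 * lob (π / 4) + 3 / 2 * log 2 * (s - π / 2) - 2 * lob (s / 2) + 2 * lob s

theorem continuous_tangentGap : Continuous tangentGap := by
  have := continuous_lob
  unfold tangentGap
  fun_prop

theorem hasDerivAt_tangentGap {s : ℝ} (h0 : 0 < s) (h1 : s < π) :
    HasDerivAt tangentGap (-log ((1 - cos s) * (1 + cos s) ^ 2) / 2) s := by
  have h := (((((hasDerivAt_id s).sub_const (π / 2)).const_mul (3 / 2 * log 2)).const_add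
    (2 * lob (π / 4))).sub ((hasDerivAt_lob_half h0 h1).const_mul 2)).add
      ((hasDerivAt_lob_of_mem h0 h1).const_mul 2)
  refine h.congr_deriv ?_
  obtain ⟨e1, e2⟩ := two_mul_log_two_mul_sin_half h0 h1
  have hc1 : cos s < 1 := by
    rw [← cos_zero]
    exact cos_lt_cos_of_nonneg_of_le_pi le_rfl h1.le h0
  have hc2 : -1 < cos s := by
    rw [← cos_pi]
    exact cos_lt_cos_of_nonneg_of_le_pi h0.le le_rfl h1
  have hc1' : 0 < 1 - cos s := by linarith
  have hc2' : 0 < 1 + cos s := by linarith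
  rw [log_mul two_ne_zero hc1'.ne'] at e1 e2
  rw [log_mul two_ne_zero hc2'.ne'] at e2
  rw [log_mul hc1'.ne' (pow_ne_zero 2 hc2'.ne'), log_pow]
  push_cast
  linarith

theorem tangentGap_062 : 0 ≤ tangentGap 0.62 := by
  have h1 := lob_031_le
  have h2 := le_lob_062
  have h3 := le_lob_pi_div_four
  have h4 := pi_lt_d4
  have h5 := log_two_lt_d9
  have h6 : log 2 * (π / 2 - 0.62) ≤ 0.6931471808 * (3.1416 / 2 - 0.62) := by
    apply mul_le_mul h5.le (by linarith) _ (by norm_num)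
    linarith [pi_gt_three]
  unfold tangentGap
  norm_num at *
  linarith

/-- With c = cos s, (1 - c)(1 + c)² - 1 = c(1 - c - c²) fixes the sign of the derivative. The gap
rises until c is the golden-ratio root of 1 - c - c², falls to its zero at π/2, then rises again.
Only the left endpoint needs numerics. -/
theorem tangentGap_nonneg {s : ℝ} (h0 : 0.62 ≤ s) (h1 : s ≤ π) : 0 ≤ tangentGap s := by
  have hs0 : (0 : ℝ) < s := by linarith
  have hpi := pi_gt_three
  have hmid : tangentGap (π / 2) = 0 := by
    rw [tangentGap, lob_pi_div_two, show π / 2 / 2 = π / 4 by ring]; ring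
  rcases le_total (π / 2) s with h | h
  · have : MonotoneOn tangentGap (Icc (π / 2) π) := by
      refine monotoneOn_of_hasDerivWithinAt_nonneg (convex_Icc _ _)
        continuous_tangentGap.continuousOn (fun t ht => ?_) (fun t ht => ?_)
        (f' := fun s => -log ((1 - cos s) * (1 + cos s) ^ 2) / 2)
      · rw [interior_Icc] at ht
        exact (hasDerivAt_tangentGap (by linarith [ht.1]) ht.2).hasDerivWithinAt
      · rw [interior_Icc] at ht
        have hc : cos t ≤ 0 := cos_nonpos_of_pi_div_two_le_of_le ht.1.le (by linarith [ht.2])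
        have hc2 := neg_one_le_cos t
        have : log ((1 - cos t) * (1 + cos t) ^ 2) ≤ 0 :=
          log_nonpos (mul_nonneg (by linarith) (sq_nonneg _))
            (by nlinarith [mul_nonneg (sq_nonneg (cos t)) (neg_le_iff_add_nonneg'.1 hc2)])
        linarith
    simpa [hmid] using this ⟨le_rfl, by linarith⟩ ⟨h, h1⟩ h
  · have hcos0 : 0 ≤ cos s := cos_nonneg_of_mem_Icc ⟨by linarith, h⟩
    rcases le_total 0 (1 - cos s - cos s ^ 2) with hc | hc
    · have : AntitoneOn tangentGap (Icc s (π / 2)) := by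
        refine antitoneOn_of_hasDerivWithinAt_nonpos (convex_Icc _ _)
          continuous_tangentGap.continuousOn (fun t ht => ?_) (fun t ht => ?_)
          (f' := fun s => -log ((1 - cos s) * (1 + cos s) ^ 2) / 2)
        · rw [interior_Icc] at ht
          exact (hasDerivAt_tangentGap (by linarith [ht.1]) (by linarith [ht.2])).hasDerivWithinAt
        · rw [interior_Icc] at ht
          have hct : 0 ≤ cos t := cos_nonneg_of_mem_Icc ⟨by linarith [ht.1], ht.2.le⟩
          have hcs : cos t ≤ cos s := cos_le_cos_of_nonneg_of_le_pi hs0.le (by linarith [ht.2]) ht.1.le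
          have : 0 ≤ log ((1 - cos t) * (1 + cos t) ^ 2) := by
            apply log_nonneg
            have : 0 ≤ cos t * (1 - cos t - cos t ^ 2) := mul_nonneg hct (by nlinarith)
            nlinarith
          linarith
      simpa [hmid] using this ⟨le_rfl, h⟩ ⟨h, le_rfl⟩ h
    · have : MonotoneOn tangentGap (Icc 0.62 s) := by
        refine monotoneOn_of_hasDerivWithinAt_nonneg (convex_Icc _ _)
          continuous_tangentGap.continuousOn (fun t ht => ?_) (fun t ht => ?_)
          (f' := fun s => -log ((1 - cos s) * (1 + cos s) ^ 2) / 2)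
        · rw [interior_Icc] at ht
          exact (hasDerivAt_tangentGap (by linarith [ht.1]) (by linarith [ht.2])).hasDerivWithinAt
        · rw [interior_Icc] at ht
          have ht0 : (0 : ℝ) < t := by linarith [ht.1]
          have hcs : cos s ≤ cos t := cos_le_cos_of_nonneg_of_le_pi ht0.le (by linarith) ht.2.le
          have hc1 := cos_le_one t
          have : log ((1 - cos t) * (1 + cos t) ^ 2) ≤ 0 := by
            apply log_nonpos (mul_nonneg (by linarith) (sq_nonneg _))
            have : cos t * (1 - cos t - cos t ^ 2) ≤ 0 :=
              mul_nonpos_of_nonneg_of_nonpos (by linarith) (by nlinarith)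
            nlinarith
          linarith
      exact tangentGap_062.trans (this ⟨le_rfl, h0⟩ ⟨h0, le_rfl⟩ h0)

theorem lob_pair_le_tangent {x y : ℝ} (hx : 0 ≤ x) (hy : 0 ≤ y) (hs : 0.62 ≤ x + y) :
    lob x + lob y - 2 * lob (x + y) ≤ 2 * lob (π / 4) + 3 / 2 * log 2 * (x + y - π / 2) := by
  rcases le_total (x + y) π with h | h
  · have h1 := lob_add_lob_le hx hy h
    have h2 := tangentGap_nonneg hs h
    unfold tangentGap at h2
    linarith
  · have h1 := (abs_le.1 (abs_lob_le x)).2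
    have h2 := (abs_le.1 (abs_lob_le y)).2
    have h3 := (abs_le.1 (abs_lob_le (x + y))).1
    have h4 := le_lob_pi_div_four
    have h5 : 0.69 * (π / 2) ≤ log 2 * (x + y - π / 2) :=
      mul_le_mul (by linarith [log_two_gt_d9]) (by linarith) (by positivity)
        (by linarith [log_two_gt_d9])
    have := pi_gt_three
    norm_num at *
    linarith

/-! ### A linear bound for the pairs avoiding a small one -/

/-- The gap between `0.549 s` and `4/3 lob (s / 2) - 2 lob s`. -/
noncomputable def slopeGap (s : ℝ) : ℝ := 0.549 * s - 4 / 3 * lob (s / 2) + 2 * lob s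

/-- The derivative of `slopeGap` in terms of `cos s`. -/
noncomputable def slopeGapDeriv (c : ℝ) : ℝ := 0.549 - log (32 * ((1 - c) ^ 2 * (1 + c) ^ 3)) / 3

theorem continuous_slopeGap : Continuous slopeGap := by
  have := continuous_lob
  unfold slopeGap
  fun_prop

theorem cos_mem_Ioo {s : ℝ} (h0 : 0 < s) (h1 : s < π) : cos s ∈ Ioo (-1) 1 := by
  constructor
  · rw [← cos_pi]
    exact cos_lt_cos_of_nonneg_of_le_pi h0.le le_rfl h1
  · rw [← cos_zero]
    exact cos_lt_cos_of_nonneg_of_le_pi le_rfl h1.le h0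

theorem hasDerivAt_slopeGap {s : ℝ} (h0 : 0 < s) (h1 : s < π) :
    HasDerivAt slopeGap (slopeGapDeriv (cos s)) s := by
  have h := (((hasDerivAt_id s).const_mul 0.549).sub
    ((hasDerivAt_lob_half h0 h1).const_mul (4 / 3))).add ((hasDerivAt_lob_of_mem h0 h1).const_mul 2)
  refine h.congr_deriv ?_
  obtain ⟨e1, e2⟩ := two_mul_log_two_mul_sin_half h0 h1
  obtain ⟨hc2, hc1⟩ := cos_mem_Ioo h0 h1
  have hc1' : 0 < 1 - cos s := by linarith
  have hc2' : 0 < 1 + cos s := by linarith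
  have e : 32 * ((1 - cos s) ^ 2 * (1 + cos s) ^ 3) =
      (2 * (1 - cos s)) ^ 2 * (2 * (1 + cos s)) ^ 3 := by ring
  rw [slopeGapDeriv, e, log_mul (x := (2 * (1 - cos s)) ^ 2) (by positivity) (by positivity),
    log_pow, log_pow]
  push_cast
  linarith

theorem hasDerivAt_sq_mul_cube (c : ℝ) :
    HasDerivAt (fun c : ℝ => (1 - c) ^ 2 * (1 + c) ^ 3) ((1 - c) * (1 + c) ^ 2 * (1 - 5 * c)) c := by
  have h := (((hasDerivAt_id c).const_sub 1).pow 2).mul (((hasDerivAt_id c).const_add 1).pow 3)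
  refine h.congr_deriv ?_
  simp
  ring

theorem monotoneOn_sq_mul_cube :
    MonotoneOn (fun c : ℝ => (1 - c) ^ 2 * (1 + c) ^ 3) (Icc (-1) (1 / 5)) := by
  refine monotoneOn_of_hasDerivWithinAt_nonneg (convex_Icc _ _) (by fun_prop)
    (fun t _ => (hasDerivAt_sq_mul_cube t).hasDerivWithinAt) (fun t ht => ?_)
  rw [interior_Icc] at ht
  exact mul_nonneg (mul_nonneg (by linarith [ht.2]) (sq_nonneg _)) (by linarith [ht.2])

theorem antitoneOn_sq_mul_cube :
    AntitoneOn (fun c : ℝ => (1 - c) ^ 2 * (1 + c) ^ 3) (Icc (1 / 5) 1) := by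
  refine antitoneOn_of_hasDerivWithinAt_nonpos (convex_Icc _ _) (by fun_prop)
    (fun t _ => (hasDerivAt_sq_mul_cube t).hasDerivWithinAt) (fun t ht => ?_)
  rw [interior_Icc] at ht
  exact mul_nonpos_of_nonneg_of_nonpos (mul_nonneg (by linarith [ht.2]) (sq_nonneg _))
    (by linarith [ht.1])

theorem slopeGapDeriv_anti {c d : ℝ} (hc : -1 < c) (hcd : c ≤ d) (hd : d ≤ 1 / 5) :
    slopeGapDeriv d ≤ slopeGapDeriv c := by
  have := monotoneOn_sq_mul_cube ⟨hc.le, hcd.trans hd⟩ ⟨hc.le.trans hcd, hd⟩ hcd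
  have h1 : 0 < 1 - c := by linarith
  have h2 : 0 < 1 + c := by linarith
  have := log_le_log (by positivity : 0 < 32 * ((1 - c) ^ 2 * (1 + c) ^ 3))
    (mul_le_mul_of_nonneg_left this (by norm_num))
  unfold slopeGapDeriv
  linarith

theorem slopeGapDeriv_mono {c d : ℝ} (hc : 1 / 5 ≤ c) (hcd : c ≤ d) (hd : d < 1) :
    slopeGapDeriv c ≤ slopeGapDeriv d := by
  have := antitoneOn_sq_mul_cube ⟨hc, (hcd.trans_lt hd).le⟩ ⟨hc.trans hcd, hd.le⟩ hcd
  have h1 : 0 < 1 - d := by linarith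
  have h2 : 0 < 1 + d := by linarith
  have := log_le_log (by positivity : 0 < 32 * ((1 - d) ^ 2 * (1 + d) ^ 3))
    (mul_le_mul_of_nonneg_left this (by norm_num))
  unfold slopeGapDeriv
  linarith

theorem cos_0925_mem : cos 0.925 ∈ Icc 0.6015 0.6022 := by
  have e : cos 0.925 = 1 - 2 * sin 0.4625 ^ 2 := by
    rw [show (0.925 : ℝ) = 2 * 0.4625 by norm_num, cos_two_mul, cos_sq']; ring
  have h1 := sub_cube_div_six_le_sin (x := 0.4625) (by norm_num)
  have h2 := sin_le_quintic (x := 0.4625) (by norm_num)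
  rw [e]
  norm_num at h1 h2 ⊢
  constructor <;> nlinarith

theorem slopeGapDeriv_bound : |slopeGapDeriv (-cos 0.925)| ≤ 0.005 := by
  obtain ⟨h1, h2⟩ := cos_0925_mem
  have hl1 : log (32 * ((1 - (-0.6015)) ^ 2 * (1 + (-0.6015)) ^ 3)) ≤ 1.662 :=
    log_le_of_le_sum (by norm_num) (by norm_num) 10
      (by norm_num [Finset.sum_range_succ, Nat.factorial])
  have hl2 : 1.632 ≤ log (32 * ((1 - (-0.6022)) ^ 2 * (1 + (-0.6022)) ^ 3)) := by
    -- The series test needs an exponent at most 1, so a number just above e is divided out first.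
    have : 0.632 ≤ log (32 * ((1 - (-0.6022)) ^ 2 * (1 + (-0.6022)) ^ 3) / 2.7182818286) :=
      le_log_of_sum_le (n := 8) (by norm_num) (by norm_num) (by norm_num) (by norm_num)
        (by norm_num [Finset.sum_range_succ, Nat.factorial])
    rw [log_div (by norm_num) (by norm_num)] at this
    have h3 : 1 ≤ log 2.7182818286 := by
      rw [le_log_iff_exp_le (by norm_num)]; exact exp_one_lt_d9.le
    linarith
  have e1 := slopeGapDeriv_anti (c := -cos 0.925) (d := -0.6015) (by linarith) (by linarith)
    (by norm_num)
  have e2 := slopeGapDeriv_anti (c := -0.6022) (d := -cos 0.925) (by norm_num) (by linarith)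
    (by linarith)
  have f1 : slopeGapDeriv (-0.6015) ≥ -0.005 := by unfold slopeGapDeriv; linarith
  have f2 : slopeGapDeriv (-0.6022) ≤ 0.005 := by unfold slopeGapDeriv; linarith
  exact abs_le.2 ⟨by linarith, by linarith⟩

theorem slopeGap_at : 0.006 ≤ slopeGap (π - 0.925) := by
  have h1 := lob_le (x := 0.925) (by norm_num) (by norm_num)
  have h2 := lob_pi_div_two_sub_le (x := 0.4625) (by norm_num) (by norm_num)
  have hl : 0.6151 ≤ log (2 * 0.925) :=
    le_log_of_sum_le (n := 8) (by norm_num) (by norm_num) (by norm_num) (by norm_num)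
      (by norm_num [Finset.sum_range_succ, Nat.factorial])
  have := pi_gt_d4
  have := log_two_lt_d9
  rw [slopeGap, lob_pi_sub, show (π - 0.925) / 2 = π / 2 - 0.4625 by ring]
  norm_num at *
  linarith

/-- The cubic-quadratic product peaks at c = 1/5, so the gap is convex on this range. Its minimum is
near π - 0.925: the value there is at least 0.006 and the slope at most 0.005 in size, and both ends
of the range are within distance 1. -/
theorem slopeGap_nonneg_of_ge {s : ℝ} (h0 : arccos (1 / 5) ≤ s) (h1 : s ≤ π) :
    0 ≤ slopeGap s := by
  have hpi := pi_gt_d4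
  have hpi' := pi_lt_d4
  have hb := abs_le.1 slopeGapDeriv_bound
  rw [← cos_pi_sub] at hb
  have hat := slopeGap_at
  have ha : cos (arccos (1 / 5)) = 1 / 5 := cos_arccos (by norm_num) (by norm_num)
  have ha1 : π / 2 - arccos (1 / 5) ≤ 0.3 := by
    rw [← arcsin_eq_pi_div_two_sub_arccos]
    apply arcsin_le_iff_le_sin' ⟨by linarith, by linarith⟩ |>.2
    have := sub_cube_div_six_le_sin (x := 0.3) (by norm_num)
    norm_num at this ⊢
    linarith
  have ha2 : 0 ≤ arccos (1 / 5) := arccos_nonneg _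
  have ha3 : arccos (1 / 5) ≤ π / 2 := arccos_le_pi_div_two.2 (by norm_num)
  rcases le_total (π - 0.925) s with h | h
  · have : MonotoneOn (fun s => slopeGap s + 0.005 * s) (Icc (π - 0.925) π) := by
      refine monotoneOn_of_hasDerivWithinAt_nonneg (convex_Icc _ _)
        (continuous_slopeGap.add (by fun_prop)).continuousOn (fun t ht => ?_) (fun t ht => ?_)
        (f' := fun s => slopeGapDeriv (cos s) + 0.005 * 1)
      · rw [interior_Icc] at ht
        exact ((hasDerivAt_slopeGap (by linarith [ht.1]) ht.2).add
          ((hasDerivAt_id t).const_mul 0.005)).hasDerivWithinAt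
      · rw [interior_Icc] at ht
        have h2 : cos t ≤ cos (π - 0.925) :=
          cos_le_cos_of_nonneg_of_le_pi (by linarith) (by linarith [ht.2]) ht.1.le
        have h3 : cos (π - 0.925) ≤ cos (arccos (1 / 5)) :=
          cos_le_cos_of_nonneg_of_le_pi ha2 (by linarith) (by linarith)
        have := slopeGapDeriv_anti (cos_mem_Ioo (by linarith [ht.1]) ht.2).1 h2 (h3.trans ha.le)
        linarith
    have := this ⟨le_rfl, by linarith⟩ ⟨h, h1⟩ h
    simp only at this
    linarith
  · have : AntitoneOn (fun s => slopeGap s - 0.005 * s) (Icc (arccos (1 / 5)) (π - 0.925)) := by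
      refine antitoneOn_of_hasDerivWithinAt_nonpos (convex_Icc _ _)
        (continuous_slopeGap.sub (by fun_prop)).continuousOn (fun t ht => ?_) (fun t ht => ?_)
        (f' := fun s => slopeGapDeriv (cos s) - 0.005 * 1)
      · rw [interior_Icc] at ht
        exact ((hasDerivAt_slopeGap (by linarith [ht.1]) (by linarith [ht.2])).sub
          ((hasDerivAt_id t).const_mul 0.005)).hasDerivWithinAt
      · rw [interior_Icc] at ht
        have h2 : cos (π - 0.925) ≤ cos t :=
          cos_le_cos_of_nonneg_of_le_pi (by linarith [ht.1]) (by linarith) ht.2.le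
        have h3 : cos t ≤ cos (arccos (1 / 5)) :=
          cos_le_cos_of_nonneg_of_le_pi ha2 (by linarith [ht.2]) ht.1.le
        have := slopeGapDeriv_anti (cos_mem_Ioo (by linarith) (by linarith)).1 h2 (h3.trans ha.le)
        linarith
    have := this ⟨h0, h⟩ ⟨h0.trans h, le_rfl⟩ h
    simp only at this
    linarith

/-- Below arccos(1/5) the gap is concave and nonnegative at both ends. The sign of the derivative at
s tells which end to compare with. -/
theorem slopeGap_nonneg {s : ℝ} (h0 : 0 ≤ s) (h1 : s ≤ π) : 0 ≤ slopeGap s := by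
  rcases le_total (arccos (1 / 5)) s with h | h
  · exact slopeGap_nonneg_of_ge h h1
  have ha : cos (arccos (1 / 5)) = 1 / 5 := cos_arccos (by norm_num) (by norm_num)
  have ha1 : arccos (1 / 5) < π := by
    rw [arccos_lt_pi]; norm_num
  have hs : 1 / 5 ≤ cos s := by
    rw [← ha]; exact cos_le_cos_of_nonneg_of_le_pi h0 ha1.le h
  rcases le_total 0 (slopeGapDeriv (cos s)) with hd | hd
  · have : MonotoneOn slopeGap (Icc 0 s) := by
      refine monotoneOn_of_hasDerivWithinAt_nonneg (convex_Icc _ _)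
        continuous_slopeGap.continuousOn (fun t ht => ?_) (fun t ht => ?_)
        (f' := fun s => slopeGapDeriv (cos s))
      · rw [interior_Icc] at ht
        exact (hasDerivAt_slopeGap ht.1 (by linarith [ht.2])).hasDerivWithinAt
      · rw [interior_Icc] at ht
        exact hd.trans (slopeGapDeriv_mono hs (cos_le_cos_of_nonneg_of_le_pi ht.1.le h1 ht.2.le)
          (cos_mem_Ioo ht.1 (by linarith [ht.2])).2)
    have := this ⟨le_rfl, h0⟩ ⟨h0, le_rfl⟩ h0
    simpa [slopeGap, lob_zero] using this
  · have h2 := slopeGap_nonneg_of_ge le_rfl ha1.le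
    rcases h0.eq_or_lt with rfl | h0'
    · simp [slopeGap, lob_zero]
    have : AntitoneOn slopeGap (Icc s (arccos (1 / 5))) := by
      refine antitoneOn_of_hasDerivWithinAt_nonpos (convex_Icc _ _)
        continuous_slopeGap.continuousOn (fun t ht => ?_) (fun t ht => ?_)
        (f' := fun s => slopeGapDeriv (cos s))
      · rw [interior_Icc] at ht
        exact (hasDerivAt_slopeGap (by linarith [ht.1]) (by linarith [ht.2])).hasDerivWithinAt
      · rw [interior_Icc] at ht
        refine le_trans (slopeGapDeriv_mono ?_ (cos_le_cos_of_nonneg_of_le_pi h0 (by linarith [ht.2])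
          ht.1.le) (cos_mem_Ioo h0' (by linarith)).2) hd
        rw [← ha]
        exact cos_le_cos_of_nonneg_of_le_pi (by linarith [ht.1]) ha1.le ht.2.le
    exact h2.trans (this ⟨le_rfl, h⟩ ⟨h, le_rfl⟩ h)

/-- The weight 2/3 is the one that arises when half of each of six terms is shared over a 3 × 3
block of pairs. -/
theorem lob_pair_le_slope {x y : ℝ} (hx : 0 ≤ x) (hy : 0 ≤ y) :
    2 / 3 * (lob x + lob y) - 2 * lob (x + y) ≤ 0.549 * (x + y) := by
  rcases le_total (x + y) π with h | h
  · have h1 := lob_add_lob_le hx hy h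
    have h2 := slopeGap_nonneg (add_nonneg hx hy) h
    unfold slopeGap at h2
    linarith
  · have h1 := (abs_le.1 (abs_lob_le x)).2
    have h2 := (abs_le.1 (abs_lob_le y)).2
    have h3 := (abs_le.1 (abs_lob_le (x + y))).1
    have := pi_gt_d4
    norm_num at *
    linarith

/-! ### The eight-variable inequality -/

/-- The bound for configurations having a pair with small sum `s`. -/
noncomputable def smallPairBound (s : ℝ) : ℝ :=
  2 * lob (s / 2) - 1 / 2 * lob s + 3 / 2 * log 2 * s + 3 / 4 * 0.549 * (2 * π - s)

theorem smallPairBound_le {s : ℝ} (h0 : 0 ≤ s) (h1 : s ≤ 0.62) :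
    smallPairBound s ≤ 8 * lob (π / 4) := by
  have hpi := pi_gt_d4
  have hmono : MonotoneOn smallPairBound (Icc 0 0.62) := by
    refine monotoneOn_of_hasDerivWithinAt_nonneg (convex_Icc _ _) ?_ (fun t ht => ?_)
      (fun t ht => ?_) (f' := fun s => 2 * (-log (2 * sin (s / 2)) / 2) - 1 / 2 * (-log (2 * sin s))
        + 3 / 2 * log 2 * 1 + 3 / 4 * 0.549 * (-1))
    · have := continuous_lob
      exact Continuous.continuousOn (by unfold smallPairBound; fun_prop)
    · rw [interior_Icc] at ht
      have ht1 : t < π := by linarith [ht.2]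
      exact (((((hasDerivAt_lob_half ht.1 ht1).const_mul 2).sub
        ((hasDerivAt_lob_of_mem ht.1 ht1).const_mul (1 / 2))).add
        ((hasDerivAt_id t).const_mul (3 / 2 * log 2))).add
        (((hasDerivAt_id t).const_sub (2 * π)).const_mul (3 / 4 * 0.549))).hasDerivWithinAt
    · rw [interior_Icc] at ht
      have ht1 : t < π := by linarith [ht.2]
      obtain ⟨e1, e2⟩ := two_mul_log_two_mul_sin_half ht.1 ht1
      have hc1 : cos t < 1 := (cos_mem_Ioo ht.1 ht1).2
      have hc0 : 0 ≤ cos t := cos_nonneg_of_mem_Icc ⟨by linarith [ht.1], by linarith [ht.2]⟩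
      have := log_le_log (by linarith : 0 < 2 * (1 - cos t))
        (by linarith : 2 * (1 - cos t) ≤ 2 * (1 + cos t))
      have := log_two_gt_d9
      norm_num at *
      linarith
  have h2 := hmono ⟨h0, h1⟩ ⟨by norm_num, le_rfl⟩ h1
  refine h2.trans ?_
  have h1 := lob_031_le
  have h2 := le_lob_062
  have h3 := le_lob_pi_div_four
  have h4 := pi_lt_d4
  have h5 := log_two_lt_d9
  unfold smallPairBound
  norm_num at *
  linarith

/-- The small pair itself is handled by midpoint concavity. In the six other pairs meeting x₀ or y₀,
that variable is dropped at a cost of log 2 per unit. This uses up half of each remaining Λ(x_i),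
Λ(y_j); the other half is absorbed by the nine remaining pairs through `lob_pair_le_slope`. -/
theorem lobSum_le_of_small_pair (x y : Fin 4 → ℝ) (hx : ∀ i, 0 ≤ x i) (hy : ∀ j, 0 ≤ y j)
    (hs : ∑ i, x i + ∑ j, y j = 2 * π) (h : x 0 + y 0 ≤ 0.62) :
    ∑ i, lob (x i) + ∑ j, lob (y j) - 1 / 2 * ∑ i, ∑ j, lob (x i + y j) ≤ 8 * lob (π / 4) := by
  refine le_trans ?_ (smallPairBound_le (add_nonneg (hx 0) (hy 0)) h)
  have h0 := lob_add_lob_le (hx 0) (hy 0) (by linarith [pi_gt_three])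
  have hr : ∀ j, lob (y j) - x 0 * log 2 ≤ lob (x 0 + y j) := fun j => lob_add_ge (hx 0)
  have hc : ∀ i, lob (x i) - y 0 * log 2 ≤ lob (x i + y 0) := fun i => by
    rw [add_comm]; exact lob_add_ge (hy 0)
  have hb : ∀ i j, 2 / 3 * (lob (x i) + lob (y j)) - 2 * lob (x i + y j) ≤ 0.549 * (x i + y j) :=
    fun i j => lob_pair_le_slope (hx i) (hy j)
  simp only [Fin.sum_univ_four] at hs ⊢
  unfold smallPairBound
  linarith [hr 1, hr 2, hr 3, hc 1, hc 2, hc 3, hb 1 1, hb 1 2, hb 1 3, hb 2 1, hb 2 2, hb 2 3,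
    hb 3 1, hb 3 2, hb 3 3]

/-- When no pair is small, four times the left side is the sum of the 16 pair expressions; the
linear parts of the tangents cancel because the pair sums average π/2. -/
theorem lobSum_le (x y : Fin 4 → ℝ) (hx : ∀ i, 0 ≤ x i) (hy : ∀ j, 0 ≤ y j)
    (hs : ∑ i, x i + ∑ j, y j = 2 * π) :
    ∑ i, lob (x i) + ∑ j, lob (y j) - 1 / 2 * ∑ i, ∑ j, lob (x i + y j) ≤ 8 * lob (π / 4) := by
  by_cases h : ∃ i j, x i + y j ≤ 0.62
  · obtain ⟨i, j, hij⟩ := h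
    have e1 : ∀ f : Fin 4 → ℝ, ∑ k, f (Equiv.swap 0 i k) = ∑ k, f k :=
      fun f => Equiv.sum_comp _ f
    have e2 : ∀ f : Fin 4 → ℝ, ∑ k, f (Equiv.swap 0 j k) = ∑ k, f k :=
      fun f => Equiv.sum_comp _ f
    have := lobSum_le_of_small_pair (fun k => x (Equiv.swap 0 i k)) (fun k => y (Equiv.swap 0 j k))
      (fun _ => hx _) (fun _ => hy _) (by rw [e1 x, e2 y, hs]) (by simpa using hij)
    rw [e1 (fun k => lob (x k)), e2 (fun k => lob (y k)),
      e1 (fun k => ∑ l, lob (x k + y (Equiv.swap 0 j l)))] at this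
    simp only [fun k => e2 (fun l => lob (x k + y l))] at this
    exact this
  · push Not at h
    have hg : ∀ i j, lob (x i) + lob (y j) - 2 * lob (x i + y j) ≤
        2 * lob (π / 4) + 3 / 2 * log 2 * (x i + y j - π / 2) :=
      fun i j => lob_pair_le_tangent (hx i) (hy j) (h i j).le
    have hsum := Finset.sum_le_sum fun i (_ : i ∈ Finset.univ) =>
      Finset.sum_le_sum fun j (_ : j ∈ Finset.univ) => hg i j
    have hl : log 2 * (∑ i, x i + ∑ j, y j) = log 2 * (2 * π) := by rw [hs]
    simp only [Fin.sum_univ_four] at hl hsum ⊢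
    linarith

/-! ### Quantum factorials as Riemann sums -/

/-- The variation function of `log (2 sin t)` on `(0, π)`. -/
noncomputable def logSinVar (t : ℝ) : ℝ :=
  if t ≤ π / 2 then log (2 * sin t) else 2 * log 2 - log (2 * sin t)

theorem log_two_mul_sin_le {t : ℝ} : log (2 * sin t) ≤ log 2 := by
  rcases eq_or_ne (sin t) 0 with h | h
  · simp [h, log_nonneg]
  · rw [← log_abs]
    apply log_le_log (by positivity)
    rw [abs_mul, abs_two]
    linarith [abs_sin_le_one t]

theorem abs_log_sin_sub_le {c b : ℝ} (hc : 0 < c) (hcb : c ≤ b) (hb : b < π) :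
    |log (2 * sin b) - log (2 * sin c)| ≤ logSinVar b - logSinVar c := by
  have hsb : 0 < sin b := sin_pos_of_pos_of_lt_pi (by linarith) hb
  have hsc : 0 < sin c := sin_pos_of_pos_of_lt_pi hc (by linarith)
  have h1 := log_two_mul_sin_le (t := b)
  have h2 := log_two_mul_sin_le (t := c)
  unfold logSinVar
  rcases le_or_gt b (π / 2) with hb2 | hb2
  · rw [if_pos hb2, if_pos (hcb.trans hb2), abs_of_nonneg]
    have := sin_le_sin_of_le_of_le_pi_div_two (by linarith) hb2 hcb
    linarith [log_le_log (by positivity) (by linarith : 2 * sin c ≤ 2 * sin b)]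
  · rw [if_neg hb2.not_ge]
    rcases le_or_gt c (π / 2) with hc2 | hc2
    · rw [if_pos hc2, abs_le]
      constructor <;> linarith
    · rw [if_neg hc2.not_ge, abs_of_nonpos]
      · linarith
      · have := sin_le_sin_of_le_of_le_pi_div_two (x := π - b) (y := π - c)
          (by linarith) (by linarith) (by linarith)
        rw [sin_pi_sub, sin_pi_sub] at this
        linarith [log_le_log (by positivity) (by linarith : 2 * sin b ≤ 2 * sin c)]

/-- The mean of log(2 sin) over [a, b] is one of its values there, so it differs from the endpoint
value by at most the variation, which telescopes over adjacent intervals. -/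
theorem abs_log_sin_add_lob_sub_le {a b : ℝ} (ha : 0 < a) (hab : a < b) (hb : b < π) :
    |log (2 * sin b) + (lob b - lob a) / (b - a)| ≤ logSinVar b - logSinVar a := by
  obtain ⟨c, hc, hd⟩ := exists_hasDerivAt_eq_slope lob (fun t => -log (2 * sin t)) hab
    continuousOn_lob (fun t ht => hasDerivAt_lob_of_mem (ha.trans ht.1) (ht.2.trans hb))
  rw [← hd, ← sub_eq_add_neg]
  have h1 := abs_log_sin_sub_le (ha.trans hc.1) hc.2.le hb
  have h2 := (abs_nonneg _).trans (abs_log_sin_sub_le ha hc.1.le (hc.2.trans hb))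
  linarith

/-- `log |{n}!|` at `q = exp (2πi/r)`. -/
noncomputable def logQFact (r n : ℕ) : ℝ :=
  ∑ j ∈ Finset.range n, log (2 * sin ((j + 1 : ℕ) * (2 * π / r)))

theorem logQFact_succ (r n : ℕ) :
    logQFact r (n + 1) = logQFact r n + log (2 * sin ((n + 1 : ℕ) * (2 * π / r))) :=
  Finset.sum_range_succ _ _

theorem one_div_le_two_mul_sin {t d : ℝ} (hd : 0 < d) (h1 : d ≤ t) (h2 : t ≤ π - d) :
    4 / π * d ≤ 2 * sin t := by
  have hpi := pi_pos
  rcases le_total t (π / 2) with h | h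
  · have := mul_le_sin (by linarith) h
    have : 2 / π * d ≤ 2 / π * t := by gcongr
    have e : 4 / π * d = 2 * (2 / π * d) := by ring
    linarith
  · have := mul_le_sin (x := π - t) (by linarith) (by linarith)
    rw [sin_pi_sub] at this
    have : 2 / π * d ≤ 2 / π * (π - t) := by gcongr; linarith
    have e : 4 / π * d = 2 * (2 / π * d) := by ring
    linarith

theorem log_sin_reflect {r j k : ℕ} (hr : 0 < r) (h : j + k = r) :
    log (2 * sin (j * (2 * π / r))) = log (2 * sin (k * (2 * π / r))) := by
  have hr' : (r : ℝ) ≠ 0 := by positivity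
  have : (j : ℝ) * (2 * π / r) = 2 * π - k * (2 * π / r) := by
    have : (j : ℝ) + k = r := by exact_mod_cast h
    field_simp
    linarith
  rw [this, sin_two_pi_sub, mul_neg, log_neg_eq_log]

/-- Oddness of r keeps 2πj/r at distance at least π/r from every multiple of π. -/
theorem sin_ne_zero_and_neg_log_le {r j : ℕ} (hr : Odd r) (hj : 1 ≤ j) (hjr : j < r) :
    sin (j * (2 * π / r)) ≠ 0 ∧ -log r ≤ log (2 * sin (j * (2 * π / r))) := by
  have hr0 : (0 : ℝ) < r := by exact_mod_cast (by omega : 0 < r)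
  have hpi := pi_pos
  have key : ∀ i : ℕ, 1 ≤ i → 2 * i < r → sin (i * (2 * π / r)) ≠ 0 ∧
      -log r ≤ log (2 * sin (i * (2 * π / r))) := by
    intro i hi hir
    have h1 : (1 : ℝ) ≤ i := by exact_mod_cast hi
    have h2 : 2 * (i : ℝ) + 1 ≤ r := by exact_mod_cast hir
    have := one_div_le_two_mul_sin (t := i * (2 * π / r)) (d := π / r) (by positivity)
      (by rw [mul_div_assoc', div_le_div_iff_of_pos_right hr0]; nlinarith)
      (by rw [mul_div_assoc', le_sub_iff_add_le, ← add_div, div_le_iff₀ hr0]; nlinarith)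
    have e : 4 / π * (π / r) = 4 / r := by field_simp
    rw [e] at this
    have h4 : (0 : ℝ) < 4 / r := by positivity
    refine ⟨by intro h; rw [h] at this; linarith, ?_⟩
    rw [← log_inv]
    apply log_le_log (by positivity)
    refine le_trans ?_ this
    rw [inv_eq_one_div]
    gcongr
    norm_num
  rcases lt_or_ge (2 * j) r with h | h
  · exact key j hj h
  · obtain ⟨m, hm⟩ := hr
    have h3 := key (r - j) (by omega) (by omega)
    have h4 := log_sin_reflect (r := r) (j := j) (k := r - j) (by omega) (by omega)
    refine ⟨?_, h4 ▸ h3.2⟩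
    have : (j : ℝ) * (2 * π / r) = 2 * π - (r - j : ℕ) * (2 * π / r) := by
      rw [Nat.cast_sub hjr.le]
      field_simp
      ring
    rw [this, sin_two_pi_sub]
    exact neg_ne_zero.2 h3.1

theorem abs_log_sin_le {r j : ℕ} (hr3 : 3 ≤ r) (hr : Odd r) (hj : 1 ≤ j) (hjr : j < r) :
    |log (2 * sin (j * (2 * π / r)))| ≤ log r := by
  rw [abs_le]
  refine ⟨(sin_ne_zero_and_neg_log_le hr hj hjr).2, log_two_mul_sin_le.trans ?_⟩
  apply log_le_log two_pos
  exact_mod_cast (by omega : 2 ≤ r)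

theorem one_le_log {r : ℕ} (hr3 : 3 ≤ r) : 1 ≤ log r := by
  rw [le_log_iff_exp_le (by positivity)]
  have : (3 : ℝ) ≤ r := by exact_mod_cast hr3
  linarith [exp_one_lt_d9]

theorem abs_lob_div_le {r : ℕ} (hr3 : 3 ≤ r) {t : ℝ} (ht : 1 / r ≤ t) :
    |lob t / t| ≤ 3 * log r := by
  have hr0 : (0 : ℝ) < r := by positivity
  have hl := one_le_log hr3
  have ht0 : 0 < t := lt_of_lt_of_le (by positivity) ht
  rw [abs_div, abs_of_pos ht0, div_le_iff₀ ht0]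
  rcases le_total t 1 with h | h
  · have h1 := le_lob ht0.le h
    have h2 := lob_le ht0.le h
    have h3 : -log r ≤ log (2 * t) := by
      rw [← log_inv]
      apply log_le_log (by positivity)
      rw [inv_eq_one_div]; linarith
    have h4 : log (2 * t) ≤ log 2 := log_le_log (by positivity) (by linarith)
    have h5 : t * log (2 * t) ≤ t * log 2 := by gcongr
    have h6 : t * -log r ≤ t * log (2 * t) := by gcongr
    have h7 : t * log 2 ≤ t * 0.7 := by gcongr; linarith [log_two_lt_d9]
    have h8 : t ^ 3 ≤ t := pow_le_of_le_one ht0.le h (by norm_num)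
    have h9 : t ^ 5 ≤ t := pow_le_of_le_one ht0.le h (by norm_num)
    have h10 : 0 < t ^ 3 := by positivity
    have h11 : t * 1 ≤ t * log r := by gcongr
    rw [abs_le]
    norm_num at *
    constructor <;> nlinarith
  · have h0 := abs_lob_le t
    norm_num at h0
    nlinarith

/-- All nodes lie in (0, π). The first interval touches the singularity at 0 and is estimated
directly; on the others the errors telescope to a difference of `logSinVar`, which is O(log r). -/
theorem abs_logQFact_add_lob_le_of_lt {r n : ℕ} (hr3 : 3 ≤ r) (hr : Odd r) (hn : 2 * n < r) :
    |logQFact r n + lob (n * (2 * π / r)) / (2 * π / r)| ≤ 10 * log r := by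
  have hr0 : (0 : ℝ) < r := by positivity
  have hl := one_le_log hr3
  have hpi := pi_gt_three
  obtain ⟨d, hd⟩ : ∃ d, d = 2 * π / r := ⟨_, rfl⟩
  have hd0 : 0 < d := by rw [hd]; positivity
  have hlt : ∀ m : ℕ, 2 * m < r → m * d < π := by
    intro m hm
    have : 2 * (m : ℝ) < r := by exact_mod_cast hm
    rw [hd, mul_div_assoc', div_lt_iff₀ hr0]
    nlinarith
  have key : ∀ m : ℕ, 2 * (m + 1) < r →
      |logQFact r (m + 1) + lob ((m + 1 : ℕ) * d) / d| ≤
        |log (2 * sin d) + lob d / d| + (logSinVar ((m + 1 : ℕ) * d) - logSinVar d) := by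
    intro m
    induction m with
    | zero => intro _; simp [logQFact, ← hd]
    | succ m ih =>
      intro hm
      have ih := ih (by omega)
      have h := abs_log_sin_add_lob_sub_le (a := (m + 1 : ℕ) * d) (b := (m + 1 + 1 : ℕ) * d)
        (by positivity) (by gcongr; omega) (hlt _ hm)
      have e : ((m + 1 + 1 : ℕ) : ℝ) * d - (m + 1 : ℕ) * d = d := by push_cast; ring
      rw [e] at h
      rw [logQFact_succ, ← hd]
      have h2 := abs_add_le (logQFact r (m + 1) + lob ((m + 1 : ℕ) * d) / d)
        (log (2 * sin ((m + 1 + 1 : ℕ) * d)) + (lob ((m + 1 + 1 : ℕ) * d) - lob ((m + 1 : ℕ) * d)) / d)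
      have e2 : logQFact r (m + 1) + lob ((m + 1 : ℕ) * d) / d +
        (log (2 * sin ((m + 1 + 1 : ℕ) * d)) + (lob ((m + 1 + 1 : ℕ) * d) - lob ((m + 1 : ℕ) * d)) / d)
        = logQFact r (m + 1) + log (2 * sin ((m + 1 + 1 : ℕ) * d)) +
          lob ((m + 1 + 1 : ℕ) * d) / d := by ring
      rw [e2] at h2
      linarith
  rcases n with _ | m
  · simp [logQFact, lob_zero]; linarith
  · have h := key m hn
    rw [← hd]
    have hv : ∀ j : ℕ, 1 ≤ j → 2 * j < r → |logSinVar (j * d)| ≤ 3 * log r := by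
      intro j hj hjr
      have := abs_le.1 (abs_log_sin_le hr3 hr hj (by omega : j < r))
      have h2 := log_two_lt_d9
      have h3 := log_two_gt_d9
      rw [← hd] at this
      unfold logSinVar
      split_ifs <;> rw [abs_le] <;> constructor <;> linarith
    have h1 := abs_le.1 (hv (m + 1) (by omega) hn)
    have h2 := abs_le.1 (hv 1 le_rfl (by omega))
    have h3 := abs_log_sin_le hr3 hr le_rfl (by omega : 1 < r)
    have h4 := abs_lob_div_le hr3 (t := d) (by rw [hd]; gcongr; linarith)
    have h5 := abs_add_le (log (2 * sin d)) (lob d / d)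
    rw [← hd] at h3
    simp only [Nat.cast_one, one_mul] at h2 h3
    linarith

theorem logQFact_reflect {r h k : ℕ} (hr : r = 2 * h + 1) (hk : k ≤ h) :
    logQFact r (h + k) = 2 * logQFact r h - logQFact r (h - k) := by
  induction k with
  | zero => simp; ring
  | succ k ih =>
    have ih := ih (by omega)
    obtain ⟨m, hm⟩ : ∃ m, h - k = m + 1 := ⟨h - k - 1, by omega⟩
    rw [hm, logQFact_succ] at ih
    rw [show h - (k + 1) = m by omega, ← add_assoc, logQFact_succ,
      log_sin_reflect (r := r) (j := h + k + 1) (k := m + 1) (by omega) (by omega)]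
    linarith

/-- Past the middle m = (r - 1)/2 the factors repeat in reverse order. The middle factorial is
itself O(log r), since Λ(md) = -Λ(π/r). -/
theorem abs_logQFact_add_lob_le {r n : ℕ} (hr3 : 3 ≤ r) (hr : Odd r) (hn : n < r) :
    |logQFact r n + lob (n * (2 * π / r)) / (2 * π / r)| ≤ 40 * log r := by
  have hl := one_le_log hr3
  have hr0 : (0 : ℝ) < r := by positivity
  have hpi := pi_gt_three
  rcases lt_or_ge (2 * n) r with h | h
  · linarith [abs_logQFact_add_lob_le_of_lt hr3 hr h]
  obtain ⟨m, hm⟩ := hr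
  obtain ⟨k, rfl⟩ : ∃ k, n = m + (k + 1) := ⟨n - m - 1, by omega⟩
  have hr : Odd r := ⟨m, hm⟩
  have e1 := logQFact_reflect hm (k := k + 1) (by omega)
  -- The reflected index is m - k - 1, but the one complementary to n modulo r is m - k; one extra
  -- factor corrects this.
  have e2 := logQFact_succ r (m - (k + 1))
  rw [show m - (k + 1) + 1 = m - k by omega] at e2
  have e3 := log_sin_reflect (r := r) (j := m - k) (k := m + (k + 1)) (by omega) (by omega)
  have b1 := abs_le.1 (abs_logQFact_add_lob_le_of_lt hr3 hr (by omega : 2 * m < r))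
  have b2 := abs_le.1 (abs_logQFact_add_lob_le_of_lt hr3 hr (by omega : 2 * (m - k) < r))
  have b3 := abs_le.1 (abs_log_sin_le hr3 hr (by omega) hn)
  have b4 := abs_le.1 (abs_lob_div_le hr3 (t := π / r) (by gcongr; linarith))
  have hrm : (r : ℝ) = 2 * m + 1 := by exact_mod_cast hm
  have f1 : lob (m * (2 * π / r)) / (2 * π / r) = -(lob (π / r) / (π / r)) / 2 := by
    have : (m : ℝ) * (2 * π / r) = π - π / r := by
      field_simp; rw [hrm]; ring
    rw [this, lob_pi_sub]
    field_simp
  have f2 : lob ((m - k : ℕ) * (2 * π / r)) = -lob ((m + (k + 1) : ℕ) * (2 * π / r)) := by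
    have : ((m - k : ℕ) : ℝ) * (2 * π / r) = 2 * π - (m + (k + 1) : ℕ) * (2 * π / r) := by
      have : ((m - k : ℕ) : ℝ) + (m + (k + 1) : ℕ) = r := by
        exact_mod_cast (by omega : m - k + (m + (k + 1)) = r)
      field_simp
      linarith
    rw [this, lob_two_pi_sub]
  rw [f1] at b1
  rw [f2, neg_div] at b2
  rw [abs_le]
  constructor <;> linarith

/-! ### Bounding the quantum 6j-symbol -/

theorem norm_qInt_rootQ (r n : ℕ) :
    ‖Quantum6j.qInt (Quantum6j.rootQ r) n‖ = |2 * sin (n * (2 * π / r))| := by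
  have h : Quantum6j.rootQ r ^ n = Complex.exp (((n * (2 * π / r) : ℝ) : ℂ) * Complex.I) := by
    rw [Quantum6j.rootQ, ← Complex.exp_nat_mul]
    congr 1
    push_cast
    ring
  have h2 : Quantum6j.qInt (Quantum6j.rootQ r) n =
      ((2 * sin (n * (2 * π / r)) : ℝ) : ℂ) * Complex.I := by
    rw [Quantum6j.qInt, h, ← Complex.exp_neg, ← neg_mul, Complex.exp_mul_I, Complex.exp_mul_I,
      Complex.cos_neg, Complex.sin_neg]
    push_cast
    ring
  rw [h2, norm_mul, Complex.norm_I, mul_one, Complex.norm_real, norm_eq_abs]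

theorem norm_qFact_rootQ {r n : ℕ} (hr : Odd r) (hn : n < r) :
    ‖Quantum6j.qFact (Quantum6j.rootQ r) n‖ = exp (logQFact r n) := by
  induction n with
  | zero => simp [Quantum6j.qFact, logQFact]
  | succ n ih =>
    have ih := ih (by omega)
    rw [Quantum6j.qFact] at ih ⊢
    rw [Finset.prod_Icc_succ_top (by omega), norm_mul, ih, norm_qInt_rootQ, logQFact_succ, exp_add]
    congr 1
    rw [← log_abs, exp_log]
    exact abs_pos.2 (mul_ne_zero two_ne_zero
      (sin_ne_zero_and_neg_log_le hr (by omega) hn).1)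

theorem qFact_rootQ_eq_zero {r n : ℕ} (hr : 0 < r) (hn : r ≤ n) :
    Quantum6j.qFact (Quantum6j.rootQ r) n = 0 := by
  refine Finset.prod_eq_zero (i := r) (Finset.mem_Icc.2 ⟨hr, hn⟩) ?_
  have hr' : (r : ℝ) ≠ 0 := by positivity
  rw [← norm_eq_zero, norm_qInt_rootQ, mul_div_cancel₀ _ hr']
  simp

theorem zeta_pos {r : ℕ} (hr3 : 3 ≤ r) : 0 < Quantum6j.zeta r := by
  have h3 : (3 : ℝ) ≤ r := by exact_mod_cast hr3
  refine mul_pos two_pos (sin_pos_of_pos_of_lt_pi (by positivity) ?_)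
  rw [div_lt_iff₀ (by positivity)]
  nlinarith [pi_pos]

theorem zeta_le_two (r : ℕ) : Quantum6j.zeta r ≤ 2 := by
  have := sin_le_one (2 * π / r)
  unfold Quantum6j.zeta
  linarith

theorem neg_log_le_log_zeta {r : ℕ} (hr3 : 3 ≤ r) (hr : Odd r) :
    -log r ≤ log (Quantum6j.zeta r) := by
  have := (sin_ne_zero_and_neg_log_le hr le_rfl (by omega : 1 < r)).2
  simpa [Quantum6j.zeta] using this

theorem norm_Delta_le {r a b c : ℕ} (hr3 : 3 ≤ r) (hr : Odd r)
    (h : Quantum6j.AdmissibleTriple r a b c) :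
    ‖Quantum6j.Delta r a b c‖ ≤ exp ((logQFact r ((a + b - c) / 2) + logQFact r ((a + c - b) / 2) +
      logQFact r ((b + c - a) / 2) - logQFact r ((a + b + c) / 2) + 2 * log r) / 2) := by
  obtain ⟨h1, h2, h3, h4, h5, h6, h7, h8⟩ := h
  have hz := zeta_pos hr3
  have hl := one_le_log hr3
  have hs := (abs_le.1 (abs_log_sin_le (j := (a + b + c) / 2 + 1) hr3 hr (by omega) (by omega))).1
  have hz2 : log (Quantum6j.zeta r) ≤ log r := by
    refine log_le_log hz ((zeta_le_two r).trans ?_)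
    exact_mod_cast (by omega : 2 ≤ r)
  have e : ((1 / 2 : ℂ)) = ((1 / 2 : ℝ) : ℂ) := by push_cast; rfl
  rw [Quantum6j.Delta, e, Complex.norm_cpow_real, norm_div, norm_mul, norm_mul, norm_mul, norm_mul,
    Complex.norm_I, one_mul, Complex.norm_real, norm_of_nonneg hz.le,
    norm_qFact_rootQ hr (by omega), norm_qFact_rootQ hr (by omega), norm_qFact_rootQ hr (by omega),
    norm_qFact_rootQ hr (by omega), logQFact_succ, ← exp_log hz, ← exp_add, ← exp_add, ← exp_add,
    ← exp_sub, ← exp_mul]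
  apply exp_le_exp.2
  linarith

/-- The left side is the logarithm of one term, with its Δ prefactors, up to O(log r). Replacing its
factorials by Λ costs 640 log r in all. -/
theorem logQFact_combination_le {r : ℕ} (hr3 : 3 ≤ r) (hr : Odd r) {T₁ T₂ T₃ T₄ Q₁ Q₂ Q₃ z : ℕ}
    (hsum : T₁ + T₂ + T₃ + T₄ = Q₁ + Q₂ + Q₃) (hz : z < r)
    (hT₁ : T₁ ≤ z) (hT₂ : T₂ ≤ z) (hT₃ : T₃ ≤ z) (hT₄ : T₄ ≤ z)
    (hQ₁ : z ≤ Q₁) (hQ₂ : z ≤ Q₂) (hQ₃ : z ≤ Q₃)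
    (hQT₁ : Q₁ < r + T₁) (hQT₁₂ : Q₁ < r + T₂) (hQT₁₃ : Q₁ < r + T₃) (hQT₁₄ : Q₁ < r + T₄)
    (hQT₂ : Q₂ < r + T₁) (hQT₂₂ : Q₂ < r + T₂) (hQT₂₃ : Q₂ < r + T₃) (hQT₂₄ : Q₂ < r + T₄)
    (hQT₃ : Q₃ < r + T₁) (hQT₃₂ : Q₃ < r + T₂) (hQT₃₃ : Q₃ < r + T₃) (hQT₃₄ : Q₃ < r + T₄) :
    (logQFact r (Q₁ - T₁) + logQFact r (Q₁ - T₂) + logQFact r (Q₁ - T₃) + logQFact r (Q₁ - T₄) +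
      logQFact r (Q₂ - T₁) + logQFact r (Q₂ - T₂) + logQFact r (Q₂ - T₃) + logQFact r (Q₂ - T₄) +
      logQFact r (Q₃ - T₁) + logQFact r (Q₃ - T₂) + logQFact r (Q₃ - T₃) + logQFact r (Q₃ - T₄)) / 2
      - (logQFact r T₁ + logQFact r T₂ + logQFact r T₃ + logQFact r T₄) / 2 + logQFact r z
      - (logQFact r (z - T₁) + logQFact r (z - T₂) + logQFact r (z - T₃) + logQFact r (z - T₄))
      - (logQFact r (Q₁ - z) + logQFact r (Q₂ - z) + logQFact r (Q₃ - z)) ≤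
    8 * lob (π / 4) / (2 * π / r) + 1000 * log r := by
  have hr0 : (0 : ℝ) < r := by positivity
  have hpi := pi_pos
  have ap : ∀ n, n < r →
      logQFact r n + lob (n * (2 * π / r)) / (2 * π / r) ≤ 40 * log r ∧
      -(40 * log r) ≤ logQFact r n + lob (n * (2 * π / r)) / (2 * π / r) :=
    fun n hn => ⟨(abs_le.1 (abs_logQFact_add_lob_le hr3 hr hn)).2,
      (abs_le.1 (abs_logQFact_add_lob_le hr3 hr hn)).1⟩
  obtain ⟨d, hd⟩ : ∃ d, d = 2 * π / r := ⟨_, rfl⟩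
  have hd0 : 0 < d := by rw [hd]; positivity
  have hrd : (r : ℝ) * d = 2 * π := by rw [hd]; field_simp
  rw [← hd] at ap ⊢
  obtain ⟨x₁, rfl⟩ := Nat.exists_eq_add_of_le hT₁
  obtain ⟨x₂, h₂⟩ := Nat.exists_eq_add_of_le hT₂
  obtain ⟨x₃, h₃⟩ := Nat.exists_eq_add_of_le hT₃
  obtain ⟨x₄, h₄⟩ := Nat.exists_eq_add_of_le hT₄
  obtain ⟨y₁, rfl⟩ := Nat.exists_eq_add_of_le hQ₁
  obtain ⟨y₂, rfl⟩ := Nat.exists_eq_add_of_le hQ₂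
  obtain ⟨y₃, rfl⟩ := Nat.exists_eq_add_of_le hQ₃
  -- The fourth y is r - z. Then x_i + y₄ = r - T_i, so reflection in 2π turns Λ(y₄) and Λ(x_i + y₄)
  -- into the terms for {z}! and {T_i}!.
  obtain ⟨y₄, hy₄⟩ := Nat.exists_eq_add_of_le hz.le
  have main := lobSum_le ![x₁ * d, x₂ * d, x₃ * d, x₄ * d] ![y₁ * d, y₂ * d, y₃ * d, y₄ * d]
    (by intro i; fin_cases i <;> simp <;> positivity)
    (by intro i; fin_cases i <;> simp <;> positivity) (by
      have : x₁ + x₂ + x₃ + x₄ + (y₁ + y₂ + y₃ + y₄) = r := by omega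
      have : (x₁ : ℝ) + x₂ + x₃ + x₄ + (y₁ + y₂ + y₃ + y₄) = r := by exact_mod_cast this
      simp [Fin.sum_univ_four]
      rw [← hrd, ← this]
      ring)
  simp only [Fin.sum_univ_four, Matrix.cons_val] at main
  have hsub : ∀ a b : ℕ, a + b = r → lob (a * d) = -lob (b * d) := by
    intro a b h
    have : (a : ℝ) * d = 2 * π - b * d := by
      rw [← hrd, ← h]; push_cast; ring
    rw [this, lob_two_pi_sub]
  have hT : ∀ x T : ℕ, T + x + y₄ = r → lob (x * d + y₄ * d) = -lob (T * d) := by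
    intro x T h
    rw [← hsub (x + y₄) T (by omega)]
    push_cast
    ring_nf
  rw [hsub y₄ (T₁ + x₁) (by omega), hT x₁ T₁ (by omega), hT x₂ T₂ (by omega),
    hT x₃ T₃ (by omega), hT x₄ T₄ (by omega)] at main
  have main := div_le_div_of_nonneg_right main hd0.le
  simp only [sub_div, add_div, neg_div, mul_div_assoc] at main ⊢
  have hp : ∀ n x : ℕ, n = x → n < r → _ := fun n _ _ hn => ap n hn
  have hq : ∀ n x y : ℕ, n = x + y → n < r →
      -(40 * log r) ≤ logQFact r n + lob (x * d + y * d) / d ∧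
      logQFact r n + lob (x * d + y * d) / d ≤ 40 * log r := by
    intro n x y h hn
    have := ap n hn
    rw [h] at this ⊢
    rw [Nat.cast_add, add_mul] at this
    exact this.symm
  have a₁ := (hq (T₁ + x₁ + y₁ - T₁) x₁ y₁ (by omega) (by omega)).2
  have a₂ := (hq (T₁ + x₁ + y₁ - T₂) x₂ y₁ (by omega) (by omega)).2
  have a₃ := (hq (T₁ + x₁ + y₁ - T₃) x₃ y₁ (by omega) (by omega)).2
  have a₄ := (hq (T₁ + x₁ + y₁ - T₄) x₄ y₁ (by omega) (by omega)).2
  have b₁ := (hq (T₁ + x₁ + y₂ - T₁) x₁ y₂ (by omega) (by omega)).2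
  have b₂ := (hq (T₁ + x₁ + y₂ - T₂) x₂ y₂ (by omega) (by omega)).2
  have b₃ := (hq (T₁ + x₁ + y₂ - T₃) x₃ y₂ (by omega) (by omega)).2
  have b₄ := (hq (T₁ + x₁ + y₂ - T₄) x₄ y₂ (by omega) (by omega)).2
  have c₁ := (hq (T₁ + x₁ + y₃ - T₁) x₁ y₃ (by omega) (by omega)).2
  have c₂ := (hq (T₁ + x₁ + y₃ - T₂) x₂ y₃ (by omega) (by omega)).2
  have c₃ := (hq (T₁ + x₁ + y₃ - T₃) x₃ y₃ (by omega) (by omega)).2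
  have c₄ := (hq (T₁ + x₁ + y₃ - T₄) x₄ y₃ (by omega) (by omega)).2
  have t₁ := (ap T₁ (by omega)).2
  have t₂ := (ap T₂ (by omega)).2
  have t₃ := (ap T₃ (by omega)).2
  have t₄ := (ap T₄ (by omega)).2
  have u := (ap (T₁ + x₁) hz).1
  have p₁ := (hp (T₁ + x₁ - T₁) x₁ (by omega) (by omega)).2
  have p₂ := (hp (T₁ + x₁ - T₂) x₂ (by omega) (by omega)).2
  have p₃ := (hp (T₁ + x₁ - T₃) x₃ (by omega) (by omega)).2
  have p₄ := (hp (T₁ + x₁ - T₄) x₄ (by omega) (by omega)).2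
  have q₁ := (hp (T₁ + x₁ + y₁ - (T₁ + x₁)) y₁ (by omega) (by omega)).2
  have q₂ := (hp (T₁ + x₁ + y₂ - (T₁ + x₁)) y₂ (by omega) (by omega)).2
  have q₃ := (hp (T₁ + x₁ + y₃ - (T₁ + x₁)) y₃ (by omega) (by omega)).2
  have e₁ : ∀ n x : ℕ, n = x → lob (n * d) / d = lob (x * d) / d := fun n x h => by rw [h]
  have f₁ := e₁ (T₁ + x₁ - T₁) x₁ (by omega)
  have f₂ := e₁ (T₁ + x₁ - T₂) x₂ (by omega)
  have f₃ := e₁ (T₁ + x₁ - T₃) x₃ (by omega)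
  have f₄ := e₁ (T₁ + x₁ - T₄) x₄ (by omega)
  have g₁ := e₁ (T₁ + x₁ + y₁ - (T₁ + x₁)) y₁ (by omega)
  have g₂ := e₁ (T₁ + x₁ + y₂ - (T₁ + x₁)) y₂ (by omega)
  have g₃ := e₁ (T₁ + x₁ + y₃ - (T₁ + x₁)) y₃ (by omega)
  have := one_le_log hr3
  linarith

/-- Identifies the twelve factorial arguments in the numerators of the four Δ's with the twelve
differences Q_j - T_i. -/
theorem half_sub_eq {a b c Q T : ℕ} (hc : c ≤ a + b) (h : a + b + 2 * T = c + 2 * Q) :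
    (a + b - c) / 2 = Q - T := by
  omega

theorem norm_summand_le {r n₁ n₂ n₃ n₄ n₅ n₆ T₁ T₂ T₃ T₄ Q₁ Q₂ Q₃ z : ℕ} (hr3 : 3 ≤ r) (hr : Odd r)
    (h : Quantum6j.Admissible r n₁ n₂ n₃ n₄ n₅ n₆)
    (eT₁ : 2 * T₁ = n₁ + n₂ + n₃) (eT₂ : 2 * T₂ = n₁ + n₅ + n₆) (eT₃ : 2 * T₃ = n₂ + n₄ + n₆)
    (eT₄ : 2 * T₄ = n₃ + n₄ + n₅) (eQ₁ : 2 * Q₁ = n₁ + n₂ + n₄ + n₅)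
    (eQ₂ : 2 * Q₂ = n₁ + n₃ + n₄ + n₆) (eQ₃ : 2 * Q₃ = n₂ + n₃ + n₅ + n₆)
    (hT₁ : T₁ ≤ z) (hT₂ : T₂ ≤ z) (hT₃ : T₃ ≤ z) (hT₄ : T₄ ≤ z)
    (hQ₁ : z ≤ Q₁) (hQ₂ : z ≤ Q₂) (hQ₃ : z ≤ Q₃) :
    ‖(Quantum6j.zeta r : ℂ)⁻¹ * Complex.I ^ (n₁ + n₂ + n₃ + n₄ + n₅ + n₆) *
      (Quantum6j.Delta r n₁ n₂ n₃ * Quantum6j.Delta r n₁ n₅ n₆ * Quantum6j.Delta r n₂ n₄ n₆ *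
        Quantum6j.Delta r n₃ n₄ n₅)‖ *
      ‖(-1 : ℂ) ^ z * Quantum6j.qFact (Quantum6j.rootQ r) (z + 1) /
        ((Quantum6j.qFact (Quantum6j.rootQ r) (z - T₁) *
          Quantum6j.qFact (Quantum6j.rootQ r) (z - T₂) *
          Quantum6j.qFact (Quantum6j.rootQ r) (z - T₃) *
          Quantum6j.qFact (Quantum6j.rootQ r) (z - T₄)) *
          (Quantum6j.qFact (Quantum6j.rootQ r) (Q₁ - z) *
          Quantum6j.qFact (Quantum6j.rootQ r) (Q₂ - z) *
          Quantum6j.qFact (Quantum6j.rootQ r) (Q₃ - z)))‖ ≤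
    exp (8 * lob (π / 4) / (2 * π / r) + 1006 * log r) := by
  rcases le_or_gt r (z + 1) with hzr | hzr
  -- Here {z + 1}! contains the factor {r} = 0.
  · rw [qFact_rootQ_eq_zero (by omega) hzr]
    simp only [mul_zero, zero_div, norm_zero]
    exact (exp_pos _).le
  have hl := one_le_log hr3
  have hz0 := zeta_pos hr3
  obtain ⟨h₁, h₂, h₃, h₄⟩ := h
  have d₁ := norm_Delta_le hr3 hr h₁
  have d₂ := norm_Delta_le hr3 hr h₂
  have d₃ := norm_Delta_le hr3 hr h₃
  have d₄ := norm_Delta_le hr3 hr h₄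
  rw [← eT₁, Nat.mul_div_cancel_left _ two_pos,
    half_sub_eq (Q := Q₁) (T := T₄) h₁.tri_c (by linarith),
    half_sub_eq (Q := Q₂) (T := T₃) h₁.tri_b (by linarith),
    half_sub_eq (Q := Q₃) (T := T₂) h₁.tri_a (by linarith)] at d₁
  rw [← eT₂, Nat.mul_div_cancel_left _ two_pos,
    half_sub_eq (Q := Q₁) (T := T₃) h₂.tri_c (by linarith),
    half_sub_eq (Q := Q₂) (T := T₄) h₂.tri_b (by linarith),
    half_sub_eq (Q := Q₃) (T := T₁) h₂.tri_a (by linarith)] at d₂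
  rw [← eT₃, Nat.mul_div_cancel_left _ two_pos,
    half_sub_eq (Q := Q₁) (T := T₂) h₃.tri_c (by linarith),
    half_sub_eq (Q := Q₃) (T := T₄) h₃.tri_b (by linarith),
    half_sub_eq (Q := Q₂) (T := T₁) h₃.tri_a (by linarith)] at d₃
  rw [← eT₄, Nat.mul_div_cancel_left _ two_pos,
    half_sub_eq (Q := Q₂) (T := T₂) h₄.tri_c (by linarith),
    half_sub_eq (Q := Q₃) (T := T₃) h₄.tri_b (by linarith),
    half_sub_eq (Q := Q₁) (T := T₁) h₄.tri_a (by linarith)] at d₄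
  obtain ⟨a11, a12, a13, -, a15, a16, a17, a18⟩ := h₁
  obtain ⟨a21, a22, a23, -, a25, a26, a27, a28⟩ := h₂
  obtain ⟨a31, a32, a33, -, a35, a36, a37, a38⟩ := h₃
  obtain ⟨a41, a42, a43, -, a45, a46, a47, a48⟩ := h₄
  have main := logQFact_combination_le (T₁ := T₁) (T₂ := T₂) (T₃ := T₃) (T₄ := T₄) (Q₁ := Q₁)
    (Q₂ := Q₂) (Q₃ := Q₃) (z := z) hr3 hr (by omega) (by omega) (by omega) (by omega) (by omega)
    (by omega) (by omega) (by omega) (by omega) (by omega) (by omega) (by omega) (by omega)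
    (by omega) (by omega) (by omega) (by omega) (by omega) (by omega) (by omega) (by omega)
  have hζ := neg_log_le_log_zeta hr3 hr
  have hsz := log_two_mul_sin_le (t := (z + 1 : ℕ) * (2 * π / r))
  have hl2 := log_two_lt_d9
  simp only [norm_mul, norm_div, norm_pow, norm_neg, norm_one, one_pow, one_mul, norm_inv,
    Complex.norm_I, mul_one, Complex.norm_real, norm_of_nonneg hz0.le]
  rw [norm_qFact_rootQ hr hzr, norm_qFact_rootQ hr (by omega : z - T₁ < r),
    norm_qFact_rootQ hr (by omega : z - T₂ < r), norm_qFact_rootQ hr (by omega : z - T₃ < r),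
    norm_qFact_rootQ hr (by omega : z - T₄ < r), norm_qFact_rootQ hr (by omega : Q₁ - z < r),
    norm_qFact_rootQ hr (by omega : Q₂ - z < r), norm_qFact_rootQ hr (by omega : Q₃ - z < r)]
  have hmul := mul_le_mul (mul_le_mul (mul_le_mul d₁ d₂ (norm_nonneg _) (exp_pos _).le) d₃
    (norm_nonneg _) (by positivity)) d₄ (norm_nonneg _) (by positivity)
  refine (mul_le_mul_of_nonneg_right (mul_le_mul_of_nonneg_left hmul (by positivity))
    (by positivity)).trans ?_
  rw [← exp_log hz0, ← exp_neg]
  simp only [← exp_add, ← exp_sub]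
  apply exp_le_exp.2
  rw [logQFact_succ]
  linarith

theorem norm_sixJ_le {r n₁ n₂ n₃ n₄ n₅ n₆ : ℕ} (hr3 : 3 ≤ r) (hr : Odd r)
    (h : Quantum6j.Admissible r n₁ n₂ n₃ n₄ n₅ n₆) :
    ‖Quantum6j.sixJ r n₁ n₂ n₃ n₄ n₅ n₆‖ ≤
      exp (8 * lob (π / 4) / (2 * π / r) + 1009 * log r) := by
  have hl := one_le_log hr3
  rw [Quantum6j.sixJ, norm_mul]
  refine (mul_le_mul_of_nonneg_left (norm_sum_le _ _) (norm_nonneg _)).trans ?_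
  rw [Finset.mul_sum]
  refine (Finset.sum_le_card_nsmul _ _
    (exp (8 * lob (π / 4) / (2 * π / r) + 1006 * log r)) fun z hz => ?_).trans ?_
  · simp only [Finset.mem_Icc, max_le_iff, le_min_iff] at hz
    obtain ⟨⟨⟨h1, h2⟩, h3, h4⟩, h5, h6, h7⟩ := hz
    have e1 := h.triple₁.even_sum
    have e2 := h.triple₂.even_sum
    have e3 := h.triple₃.even_sum
    have e4 := h.triple₄.even_sum
    rw [Nat.even_iff] at e1 e2 e3 e4
    exact norm_summand_le hr3 hr h (by omega) (by omega) (by omega) (by omega) (by omega) (by omega)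
      (by omega) h1 h2 h3 h4 h5 h6 h7
  · have e : 8 * lob (π / 4) / (2 * π / r) + 1009 * log r =
        3 * log r + (8 * lob (π / 4) / (2 * π / r) + 1006 * log r) := by ring
    rw [e, exp_add (3 * log r), nsmul_eq_mul]
    refine mul_le_mul_of_nonneg_right ?_ (exp_pos _).le
    have hr0 : (0 : ℝ) < r := by positivity
    have e2 : exp (3 * log r) = ((r ^ 3 : ℕ) : ℝ) := by
      rw [mul_comm, exp_mul, exp_log hr0]
      norm_cast
    rw [e2, Nat.cast_le, Nat.card_Icc]
    have hQ : min ((n₁ + n₂ + n₄ + n₅) / 2) (min ((n₁ + n₃ + n₄ + n₆) / 2)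
      ((n₂ + n₃ + n₅ + n₆) / 2)) ≤ 2 * r := by
      have := h.triple₁.a_le
      have := h.triple₁.b_le
      have := h.triple₃.b_le
      have := h.triple₂.b_le
      exact (min_le_left _ _).trans (by omega)
    have : 9 * r ≤ r ^ 3 := by
      rw [pow_succ]
      exact Nat.mul_le_mul_right _ (by nlinarith)
    omega

theorem log_norm_sixJ_le {r n₁ n₂ n₃ n₄ n₅ n₆ : ℕ} (hr3 : 3 ≤ r) (hr : Odd r)
    (h : Quantum6j.Admissible r n₁ n₂ n₃ n₄ n₅ n₆) :
    2 * π / r * log ‖Quantum6j.sixJ r n₁ n₂ n₃ n₄ n₅ n₆‖ ≤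
      8 * lob (π / 4) + 2018 * π * (log r / r) := by
  have hr0 : (0 : ℝ) < r := by positivity
  have hl := one_le_log hr3
  have hpi := pi_pos
  have h4 := le_lob_pi_div_four
  rcases (norm_nonneg (Quantum6j.sixJ r n₁ n₂ n₃ n₄ n₅ n₆)).eq_or_lt with h0 | h0
  -- With the convention log 0 = 0, a vanishing symbol still requires a nonnegative right-hand side.
  · rw [← h0, log_zero, mul_zero]
    have : 0 ≤ 2018 * π * (log r / r) := by positivity
    norm_num at *
    linarith
  · have := (log_le_iff_le_exp h0).2 (norm_sixJ_le hr3 hr h)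
    calc _ ≤ 2 * π / r * (8 * lob (π / 4) / (2 * π / r) + 1009 * log r) := by gcongr
      _ = _ := by field_simp; ring

/-! ### The volume of the regular ideal octahedron -/

theorem idealOctahedron_eq :
    Quantum6j.idealOctahedron = {x : EuclideanSpace ℝ (Fin 3) | |x 0| + |x 1| + |x 2| ≤ 1} := by
  apply Subset.antisymm
  · refine convexHull_min ?_ ?_
    · rintro x (⟨i, rfl⟩ | ⟨i, rfl⟩) <;> fin_cases i <;> simp
    · intro x hx y hy a b ha hb hab
      simp only [mem_ofPred_eq, PiLp.add_apply, PiLp.smul_apply, smul_eq_mul] at hx hy ⊢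
      have key : ∀ i, |a * x i + b * y i| ≤ a * |x i| + b * |y i| := fun i => by
        refine (abs_add_le _ _).trans_eq ?_
        rw [abs_mul, abs_mul, abs_of_nonneg ha, abs_of_nonneg hb]
      nlinarith [key 0, key 1, key 2, mul_le_mul_of_nonneg_left hx ha,
        mul_le_mul_of_nonneg_left hy hb]
  · intro x hx
    rw [mem_ofPred_eq] at hx
    have hconv : Convex ℝ Quantum6j.idealOctahedron := convex_convexHull ℝ _
    have hp : ∀ i, EuclideanSpace.single i (1 : ℝ) ∈ Quantum6j.idealOctahedron := fun i =>
      subset_convexHull ℝ _ (Or.inl ⟨i, rfl⟩)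
    have hn : ∀ i, EuclideanSpace.single i (-1 : ℝ) ∈ Quantum6j.idealOctahedron := fun i =>
      subset_convexHull ℝ _ (Or.inr ⟨i, rfl⟩)
    have h0 : (0 : EuclideanSpace ℝ (Fin 3)) ∈ Quantum6j.idealOctahedron := by
      have := hconv (hp 0) (hn 0) (a := 1 / 2) (b := 1 / 2) (by norm_num) (by norm_num) (by norm_num)
      convert this using 1
      ext i; simp [PiLp.single_apply]
      split_ifs <;> norm_num
    have hs : ∀ i, EuclideanSpace.single i (if 0 ≤ x i then (1 : ℝ) else -1) ∈
        Quantum6j.idealOctahedron := fun i => by split_ifs; exacts [hp i, hn i]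
    have habs : ∀ i, |x i| * (if 0 ≤ x i then (1 : ℝ) else -1) = x i := fun i => by
      split_ifs with h
      · rw [abs_of_nonneg h, mul_one]
      · rw [abs_of_neg (not_le.1 h)]; ring
    have := hconv.sum_mem (t := Finset.univ) (w := ![|x 0|, |x 1|, |x 2|, 1 - |x 0| - |x 1| - |x 2|])
      (z := ![EuclideanSpace.single 0 (if 0 ≤ x 0 then (1 : ℝ) else -1),
        EuclideanSpace.single 1 (if 0 ≤ x 1 then (1 : ℝ) else -1),
        EuclideanSpace.single 2 (if 0 ≤ x 2 then (1 : ℝ) else -1), 0])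
      (by intro i _; fin_cases i <;> simp; linarith)
      (by simp [Fin.sum_univ_four])
      (by intro i _; fin_cases i <;> simp only [Fin.zero_eta, Fin.mk_one, Fin.reduceFinMk, Matrix.cons_val]; exacts [hs 0, hs 1, hs 2, h0])
    convert this using 1
    ext i
    rw [Fin.sum_univ_four]
    simp only [Matrix.cons_val, PiLp.add_apply, PiLp.smul_apply, smul_eq_mul,
      PiLp.single_apply, PiLp.zero_apply]
    fin_cases i
    · simpa using (habs 0).symm
    · simpa using (habs 1).symm
    · simpa using (habs 2).symm

/-- The hyperbolic density of the octahedron in coordinates `(z, (x, y))`. -/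
noncomputable def octahedronDensity (z : ℝ) (p : ℝ × ℝ) : ℝ≥0∞ :=
  if |z| + |p.1| + |p.2| ≤ 1 then ENNReal.ofReal (((1 - z ^ 2 - p.1 ^ 2 - p.2 ^ 2) ^ 2)⁻¹) else 0

theorem measurable_octahedronDensity : Measurable fun q : ℝ × (ℝ × ℝ) => octahedronDensity q.1 q.2 := by
  refine Measurable.ite (measurableSet_le ?_ measurable_const) ?_ measurable_const
  · exact Continuous.measurable (by fun_prop)
  · fun_prop

theorem measurable_octahedronDensity_right (z : ℝ) : Measurable (octahedronDensity z) :=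
  measurable_octahedronDensity.comp (by fun_prop : Measurable fun p : ℝ × ℝ => (z, p))

theorem measurePreserving_coords :
    MeasurePreserving (fun x : EuclideanSpace ℝ (Fin 3) => (x 0, (x 1, x 2))) volume volume := by
  have h1 := PiLp.volume_preserving_ofLp (Fin 3)
  have h2 := volume_preserving_piFinSuccAbove (fun _ : Fin 3 => ℝ) 0
  have h3 := (MeasurePreserving.id (volume : Measure ℝ)).prod (volume_preserving_finTwoArrow ℝ)
  exact h3.comp (h2.comp h1)

theorem hyperbolicVolume_octahedron :
    Quantum6j.hyperbolicVolume Quantum6j.idealOctahedron = ∫⁻ z, ∫⁻ p, octahedronDensity z p := by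
  classical
  have hmeas : MeasurableSet Quantum6j.idealOctahedron := by
    rw [idealOctahedron_eq]
    exact measurableSet_le (by fun_prop) measurable_const
  have hp : ∫⁻ z, ∫⁻ p, octahedronDensity z p =
      ∫⁻ q : ℝ × (ℝ × ℝ), octahedronDensity q.1 q.2 := by
    exact (lintegral_prod _ measurable_octahedronDensity.aemeasurable).symm
  rw [hp, ← measurePreserving_coords.lintegral_comp measurable_octahedronDensity,
    Quantum6j.hyperbolicVolume, withDensity_apply _ hmeas, Measure.restrict_restrict hmeas,
    ← lintegral_indicator (hmeas.inter Metric.isOpen_ball.measurableSet)]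
  refine lintegral_congr fun x => ?_
  have hn : ‖x‖ ^ 2 = x 0 ^ 2 + x 1 ^ 2 + x 2 ^ 2 := by
    rw [EuclideanSpace.norm_sq_eq, Fin.sum_univ_three]
    simp
  have hd : 1 - x 0 ^ 2 - x 1 ^ 2 - x 2 ^ 2 = 1 - ‖x‖ ^ 2 := by rw [hn]; ring
  simp only [octahedronDensity, hd]
  rw [indicator_apply, idealOctahedron_eq]
  simp only [mem_inter_iff, mem_ofPred_eq, Metric.mem_ball, dist_zero_right]
  by_cases h : |x 0| + |x 1| + |x 2| ≤ 1
  · simp only [h, true_and, if_true]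
    split_ifs with hx
    · rfl
    -- Octahedron points off the open ball have norm 1, and there the density evaluates to 0 by the
    -- convention 0⁻¹ = 0.
    · have h1 : ‖x‖ ^ 2 ≤ 1 := by
        rw [hn, ← sq_abs (x 0), ← sq_abs (x 1), ← sq_abs (x 2)]
        nlinarith [abs_nonneg (x 0), abs_nonneg (x 1), abs_nonneg (x 2),
          mul_nonneg (abs_nonneg (x 0)) (abs_nonneg (x 1)),
          mul_nonneg (abs_nonneg (x 0)) (abs_nonneg (x 2)),
          mul_nonneg (abs_nonneg (x 1)) (abs_nonneg (x 2))]
      have h2 : ‖x‖ = 1 := le_antisymm (by nlinarith [norm_nonneg x]) (not_lt.1 hx)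
      simp [h2]
  · simp [h]

theorem lintegral_prod_scale {g : ℝ × ℝ → ℝ≥0∞} (hg : Measurable g) {c : ℝ} (hc : 0 < c) :
    ∫⁻ p, g p = ∫⁻ p, ENNReal.ofReal (c ^ 2) * g (c • p) := by
  have hm : Measurable fun p : ℝ × ℝ => c • p := by fun_prop
  have hgm : Measurable fun p => g (c • p) := hg.comp hm
  rw [lintegral_const_mul _ hgm, ← lintegral_map hg hm,
    Measure.map_addHaar_smul _ hc.ne', lintegral_smul_measure, smul_eq_mul, ← mul_assoc,
    ← ENNReal.ofReal_mul (by positivity)]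
  have : c ^ 2 * |(c ^ Module.finrank ℝ (ℝ × ℝ))⁻¹| = 1 := by
    rw [Module.finrank_prod, Module.finrank_self, abs_of_pos (by positivity)]
    field_simp
  rw [this]; simp

/-- The density after projecting from the ideal vertex. -/
noncomputable def coneDensity (t : ℝ) (p : ℝ × ℝ) : ℝ≥0∞ :=
  if |p.1| + |p.2| ≤ 1 then
    ENNReal.ofReal (((1 + t - (1 - t) * (p.1 ^ 2 + p.2 ^ 2)) ^ 2)⁻¹) else 0

theorem measurable_coneDensity : Measurable fun q : ℝ × (ℝ × ℝ) => coneDensity q.1 q.2 := by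
  refine Measurable.ite (measurableSet_le ?_ measurable_const) ?_ measurable_const
  · exact Continuous.measurable (by fun_prop)
  · fun_prop

/-- Scaling the slice at height z to the unit diamond has Jacobian (1 - |z|)², which cancels the
square of the factor 1 - |z| pulled out of 1 - ‖x‖². -/
theorem lintegral_octahedronDensity {z : ℝ} (hz : |z| < 1) :
    ∫⁻ p, octahedronDensity z p = ∫⁻ p, coneDensity |z| p := by
  have hc : 0 < 1 - |z| := by linarith
  rw [lintegral_prod_scale (measurable_octahedronDensity_right z) hc]
  refine lintegral_congr fun p => ?_
  simp only [octahedronDensity, coneDensity, Prod.smul_fst, Prod.smul_snd, smul_eq_mul,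
    abs_mul, abs_of_pos hc]
  have : |z| + (1 - |z|) * |p.1| + (1 - |z|) * |p.2| ≤ 1 ↔ |p.1| + |p.2| ≤ 1 := by
    constructor
    · intro h
      by_contra! h2
      nlinarith
    · intro h
      nlinarith
  simp only [this]
  split_ifs
  · rw [← ENNReal.ofReal_mul (by positivity)]
    congr 1
    have e : 1 - z ^ 2 - ((1 - |z|) * p.1) ^ 2 - ((1 - |z|) * p.2) ^ 2 =
        (1 - |z|) * (1 + |z| - (1 - |z|) * (p.1 ^ 2 + p.2 ^ 2)) := by
      rw [← sq_abs z]; ring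
    rw [e, mul_pow, mul_inv, ← mul_assoc, mul_inv_cancel₀ (by positivity), one_mul]
  · simp

theorem setLIntegral_abs (g : ℝ → ℝ≥0∞) :
    ∫⁻ z in Ioo (-1) 1, g |z| = 2 * ∫⁻ z in Ioo (0 : ℝ) 1, g z := by
  have h1 : ∫⁻ z in Ico (0 : ℝ) 1, g |z| = ∫⁻ z in Ioo (0 : ℝ) 1, g z := by
    rw [setLIntegral_congr Ioo_ae_eq_Ico.symm]
    exact setLIntegral_congr_fun measurableSet_Ioo fun z hz => by simp only [abs_of_pos hz.1]
  have h2 : ∫⁻ z in Ioo (-1 : ℝ) 0, g |z| = ∫⁻ z in Ioo (0 : ℝ) 1, g z := by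
    rw [← lintegral_indicator measurableSet_Ioo, ← lintegral_indicator measurableSet_Ioo,
      ← lintegral_neg_eq_self]
    refine lintegral_congr fun z => ?_
    by_cases h : z ∈ Ioo (0 : ℝ) 1
    · have h' : -z ∈ Ioo (-1 : ℝ) 0 := ⟨by linarith [h.2], by linarith [h.1]⟩
      rw [indicator_of_mem h, indicator_of_mem h', abs_neg, abs_of_pos h.1]
    · have h' : -z ∉ Ioo (-1 : ℝ) 0 := fun h' => h ⟨by linarith [h'.2], by linarith [h'.1]⟩
      rw [indicator_of_notMem h, indicator_of_notMem h']
  rw [← Ioo_union_Ico_eq_Ioo (by norm_num : (-1 : ℝ) < 0) zero_le_one,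
    lintegral_union measurableSet_Ico, h1, h2, two_mul]
  exact Set.disjoint_left.2 fun x hx hx' => absurd hx.2 hx'.1.not_gt

theorem lintegral_cone {m : ℝ} (h0 : 0 ≤ m) (h1 : m < 1) :
    ∫⁻ z in Ioo (0 : ℝ) 1, ENNReal.ofReal (((1 + z - (1 - z) * m) ^ 2)⁻¹) =
      ENNReal.ofReal (1 / (2 * (1 - m))) := by
  have hpos : ∀ z ∈ Icc (0 : ℝ) 1, 0 < 1 + z - (1 - z) * m := by
    intro z hz
    nlinarith [hz.1, hz.2]
  have hcont : ContinuousOn (fun z : ℝ => ((1 + z - (1 - z) * m) ^ 2)⁻¹) (uIcc 0 1) := by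
    rw [uIcc_of_le zero_le_one]
    exact ContinuousOn.inv₀ (by fun_prop) fun z hz => (pow_pos (hpos z hz) 2).ne'
  have hint : ∫ z in (0 : ℝ)..1, ((1 + z - (1 - z) * m) ^ 2)⁻¹ = 1 / (2 * (1 - m)) := by
    rw [integral_eq_sub_of_hasDerivAt (f := fun z => -(1 / (1 + m)) * (1 + z - (1 - z) * m)⁻¹)
      ?_ hcont.intervalIntegrable]
    · have : 1 - m ≠ 0 := by linarith
      have : 1 + m ≠ 0 := by linarith
      simp only [sub_self, zero_mul, sub_zero, add_zero, one_mul]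
      field_simp
      ring
    · intro z hz
      rw [uIcc_of_le zero_le_one] at hz
      have hz' := hpos z hz
      have hd : HasDerivAt (fun z => 1 + z - (1 - z) * m) (1 + m) z := by
        have := ((hasDerivAt_id z).const_add 1).sub (((hasDerivAt_id z).const_sub 1).mul_const m)
        exact this.congr_deriv (by ring)
      refine ((hd.inv hz'.ne').const_mul _).congr_deriv ?_
      have : 1 + m ≠ 0 := by linarith
      field_simp
  rw [← hint, integral_of_le zero_le_one, ← restrict_Ioo_eq_restrict_Ioc,
    ofReal_integral_eq_lintegral_ofReal]
  · exact (intervalIntegrable_iff_integrableOn_Ioo_of_le zero_le_one).1 hcont.intervalIntegrable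
  · exact Filter.Eventually.of_forall fun z => inv_nonneg.2 (sq_nonneg _)

theorem hyperbolicVolume_octahedron_eq_diamond :
    Quantum6j.hyperbolicVolume Quantum6j.idealOctahedron =
      ∫⁻ p : ℝ × ℝ, if |p.1| + |p.2| ≤ 1 then
        ENNReal.ofReal (1 / (1 - (p.1 ^ 2 + p.2 ^ 2))) else 0 := by
  have h1 : ∫⁻ z, ∫⁻ p, octahedronDensity z p = ∫⁻ z in Ioo (-1 : ℝ) 1, ∫⁻ p, coneDensity |z| p := by
    rw [← lintegral_indicator measurableSet_Ioo]
    have hne : ∀ᵐ z : ℝ, z ≠ 1 ∧ z ≠ -1 :=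
      (Measure.ae_ne volume 1).and (Measure.ae_ne volume (-1))
    refine lintegral_congr_ae ?_
    filter_upwards [hne] with z hz
    by_cases h : z ∈ Ioo (-1 : ℝ) 1
    · rw [indicator_of_mem h, lintegral_octahedronDensity (abs_lt.2 h)]
    · rw [indicator_of_notMem h, lintegral_eq_zero_iff
        (measurable_octahedronDensity_right z)]
      refine Filter.Eventually.of_forall fun p => ?_
      have hz1 : 1 < |z| := by
        refine lt_of_le_of_ne (not_lt.1 fun h' => h (abs_lt.1 h')) fun h' => ?_
        rcases (abs_eq zero_le_one).1 h'.symm with h2 | h2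
        exacts [hz.1 h2, hz.2 h2]
      simp only [octahedronDensity, Pi.zero_apply]
      rw [if_neg]
      linarith [abs_nonneg p.1, abs_nonneg p.2]
  rw [hyperbolicVolume_octahedron, h1, setLIntegral_abs (fun t => ∫⁻ p, coneDensity t p),
    lintegral_lintegral_swap measurable_coneDensity.aemeasurable, ← lintegral_const_mul]
  swap
  · exact Measurable.lintegral_prod_left' (f := fun q : ℝ × (ℝ × ℝ) => coneDensity q.1 q.2)
      measurable_coneDensity
  have hne1 : ∀ᵐ p : ℝ × ℝ, p.1 ≠ 0 :=
    Measure.quasiMeasurePreserving_fst.ae (Measure.ae_ne volume (0 : ℝ))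
  have hne2 : ∀ᵐ p : ℝ × ℝ, p.2 ≠ 0 :=
    Measure.quasiMeasurePreserving_snd.ae (Measure.ae_ne volume (0 : ℝ))
  refine lintegral_congr_ae ?_
  filter_upwards [hne1, hne2] with p hp1 hp2
  simp only [coneDensity]
  split_ifs with h
  · have hm : p.1 ^ 2 + p.2 ^ 2 < 1 := by
      rw [← sq_abs p.1, ← sq_abs p.2]
      have := mul_pos (abs_pos.2 hp1) (abs_pos.2 hp2)
      nlinarith [abs_nonneg p.1, abs_nonneg p.2]
    rw [lintegral_cone (by positivity) hm, ← ENNReal.ofReal_ofNat 2,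
      ← ENNReal.ofReal_mul (by norm_num)]
    congr 1
    have : 1 - (p.1 ^ 2 + p.2 ^ 2) ≠ 0 := by linarith
    field_simp
  · simp

/-- The radial integral of the diamond in direction `θ`. -/
noncomputable def radialIntegral (θ : ℝ) : ℝ :=
  (log (2 * (1 + |sin (2 * θ)|)) - log (2 * sin (2 * θ))) / 2

/-- The ray leaves the diamond at radius 1/w with w = |cos θ| + |sin θ| and w² = 1 + |sin 2θ|; the
integrand t/(1 - t²) is elementary. -/
theorem lintegral_radial {θ : ℝ} (h : sin (2 * θ) ≠ 0) :
    ∫⁻ t in Ioi (0 : ℝ), ENNReal.ofReal t * (if |t * cos θ| + |t * sin θ| ≤ 1 then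
      ENNReal.ofReal (1 / (1 - ((t * cos θ) ^ 2 + (t * sin θ) ^ 2))) else 0) =
    ENNReal.ofReal (radialIntegral θ) := by
  obtain ⟨w, hw⟩ : ∃ w, w = |cos θ| + |sin θ| := ⟨_, rfl⟩
  have hw2 : w ^ 2 = 1 + |sin (2 * θ)| := by
    rw [hw, sin_two_mul, abs_mul, abs_mul, abs_two, add_sq, sq_abs, sq_abs]
    linarith [sin_sq_add_cos_sq θ]
  have hsp : 0 < |sin (2 * θ)| := abs_pos.2 h
  have hw0 : 0 ≤ w := by rw [hw]; positivity
  have hw1 : 1 < w := by nlinarith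
  have hR : 0 < w⁻¹ := by positivity
  have hR1 : w⁻¹ < 1 := inv_lt_one_of_one_lt₀ hw1
  have h1 : ∫⁻ t in Ioi (0 : ℝ), ENNReal.ofReal t * (if |t * cos θ| + |t * sin θ| ≤ 1 then
      ENNReal.ofReal (1 / (1 - ((t * cos θ) ^ 2 + (t * sin θ) ^ 2))) else 0) =
      ∫⁻ t in Ioc 0 w⁻¹, ENNReal.ofReal (t / (1 - t ^ 2)) := by
    rw [← lintegral_indicator measurableSet_Ioi, ← lintegral_indicator measurableSet_Ioc]
    refine lintegral_congr fun t => ?_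
    by_cases ht : 0 < t
    · have e : |t * cos θ| + |t * sin θ| ≤ 1 ↔ t ≤ w⁻¹ := by
        rw [abs_mul, abs_mul, abs_of_pos ht, ← mul_add, ← hw, ← one_div, le_div_iff₀ (by linarith)]
      have e2 : (t * cos θ) ^ 2 + (t * sin θ) ^ 2 = t ^ 2 := by
        linear_combination t ^ 2 * sin_sq_add_cos_sq θ
      rw [indicator_of_mem (mem_Ioi.2 ht)]
      simp only [e, e2]
      by_cases ht2 : t ≤ w⁻¹
      · rw [if_pos ht2, indicator_of_mem (mem_Ioc.2 ⟨ht, ht2⟩), ← ENNReal.ofReal_mul ht.le]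
        congr 1
        ring
      · rw [if_neg ht2, indicator_of_notMem (fun h => ht2 h.2), mul_zero]
    · rw [indicator_of_notMem (fun h : t ∈ Ioi (0 : ℝ) => ht h), indicator_of_notMem (fun h => ht h.1)]
  have hpos : ∀ t ∈ uIcc 0 w⁻¹, 0 < 1 - t ^ 2 := by
    intro t ht
    rw [uIcc_of_le hR.le] at ht
    nlinarith [ht.1, ht.2]
  have hcont : ContinuousOn (fun t : ℝ => t / (1 - t ^ 2)) (uIcc 0 w⁻¹) :=
    ContinuousOn.div (by fun_prop) (by fun_prop) fun t ht => (hpos t ht).ne'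
  have hint : ∫ t in (0 : ℝ)..w⁻¹, t / (1 - t ^ 2) = radialIntegral θ := by
    rw [integral_eq_sub_of_hasDerivAt (f := fun t => -(1 / 2) * log (1 - t ^ 2)) ?_
      hcont.intervalIntegrable]
    · have e : 1 - w⁻¹ ^ 2 = (2 * |sin (2 * θ)|) / (2 * (1 + |sin (2 * θ)|)) := by
        rw [inv_pow, hw2]
        field_simp
        ring
      rw [radialIntegral, e, log_div (by positivity) (by positivity)]
      have : log (2 * sin (2 * θ)) = log (2 * |sin (2 * θ)|) := by
        rw [← log_abs, abs_mul, abs_two]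
      rw [this]
      simp
      ring
    · intro t ht
      have hd := (((hasDerivAt_pow 2 t).const_sub 1).log (hpos t ht).ne').const_mul (-(1 / 2))
      refine hd.congr_deriv ?_
      have := (hpos t ht).ne'
      simp
      field_simp
  rw [h1, ← hint, integral_of_le hR.le, ofReal_integral_eq_lintegral_ofReal]
  · exact (intervalIntegrable_iff_integrableOn_Ioc_of_le hR.le).1 hcont.intervalIntegrable
  · refine (ae_restrict_iff' measurableSet_Ioc).2 (Filter.Eventually.of_forall fun t ht => ?_)
    exact div_nonneg ht.1.le (hpos t (by rw [uIcc_of_le hR.le]; exact ⟨ht.1.le, ht.2⟩)).le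

theorem radialIntegral_nonneg (θ : ℝ) : 0 ≤ radialIntegral θ := by
  refine div_nonneg (sub_nonneg.2 ?_) two_pos.le
  rcases eq_or_ne (sin (2 * θ)) 0 with h | h
  · simp [h, log_nonneg]
  · rw [← log_abs (2 * sin (2 * θ)), abs_mul, abs_two]
    have := abs_pos.2 h
    exact log_le_log (by positivity) (by linarith)

theorem ae_sin_two_mul_ne_zero : ∀ᵐ θ : ℝ, sin (2 * θ) ≠ 0 := by
  have hc : ({θ : ℝ | sin (2 * θ) = 0}).Countable := by
    have : {θ : ℝ | sin (2 * θ) = 0} ⊆ range (fun n : ℤ => (n : ℝ) * π / 2) := by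
      intro θ h
      obtain ⟨n, hn⟩ := sin_eq_zero_iff.1 h
      exact ⟨n, by simp only [hn]; ring⟩
    exact (countable_range _).mono this
  exact hc.ae_notMem volume

theorem lintegral_diamond :
    (∫⁻ p : ℝ × ℝ, if |p.1| + |p.2| ≤ 1 then
        ENNReal.ofReal (1 / (1 - (p.1 ^ 2 + p.2 ^ 2))) else 0) =
      ∫⁻ θ in Ioo (-π) π, ENNReal.ofReal (radialIntegral θ) := by
  have hm : Measurable fun p : ℝ × ℝ => ENNReal.ofReal p.1 *
      (if |p.1 * cos p.2| + |p.1 * sin p.2| ≤ 1 then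
        ENNReal.ofReal (1 / (1 - ((p.1 * cos p.2) ^ 2 + (p.1 * sin p.2) ^ 2))) else 0) := by
    refine Measurable.mul (by fun_prop) (Measurable.ite (measurableSet_le ?_ measurable_const) ?_
      measurable_const)
    · exact Continuous.measurable (by fun_prop)
    · fun_prop
  rw [← lintegral_comp_polarCoord_symm, polarCoord_target]
  simp only [polarCoord_symm_apply, smul_eq_mul]
  rw [Measure.volume_eq_prod, setLIntegral_prod_symm _ hm.aemeasurable]
  refine setLIntegral_congr_fun_ae measurableSet_Ioo ?_
  filter_upwards [ae_sin_two_mul_ne_zero] with θ hθ _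
  exact lintegral_radial hθ

theorem intervalIntegrable_log_one_add_abs_sin (a b : ℝ) :
    IntervalIntegrable (fun θ => log (2 * (1 + |sin (2 * θ)|))) volume a b := by
  refine Continuous.intervalIntegrable (Continuous.log (by fun_prop) fun θ => ?_) _ _
  positivity

theorem intervalIntegrable_log_sin_two_mul (a b : ℝ) :
    IntervalIntegrable (fun θ => log (2 * sin (2 * θ))) volume a b := by
  have := (intervalIntegrable_log_two_mul_sin (2 * a) (2 * b)).comp_mul_left (c := 2)
  simpa using this

theorem integral_log_sin_two_mul : ∫ θ in (-π)..π, log (2 * sin (2 * θ)) = 0 := by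
  rw [integral_comp_mul_left (fun θ => log (2 * sin θ)) two_ne_zero,
    ← integral_add_adjacent_intervals (intervalIntegrable_log_two_mul_sin _ 0)
      (intervalIntegrable_log_two_mul_sin 0 _)]
  have h1 : ∫ t in (0 : ℝ)..2 * π, log (2 * sin t) = 0 := by
    have : lob (2 * π) = 0 := by rw [two_mul, lob_add_pi, lob_pi]
    rw [lob] at this; linarith
  have h2 : ∫ t in (0 : ℝ)..2 * -π, log (2 * sin t) = 0 := by
    have : lob (2 * -π) = 0 := by rw [mul_neg, lob_neg, two_mul, lob_add_pi, lob_pi, neg_zero]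
    rw [lob] at this; linarith
  rw [integral_symm, h1, h2]
  simp

/-- By periodicity this is four times the integral over [0, π/2], where 2(1 + sin 2θ) = (2 sin(θ +
π/4))²; the result is a difference of values of Λ at π/4 and 3π/4. -/
theorem integral_log_one_add_abs_sin :
    ∫ θ in (-π)..π, log (2 * (1 + |sin (2 * θ)|)) = 16 * lob (π / 4) := by
  have hper : Function.Periodic (fun θ => log (2 * (1 + |sin (2 * θ)|))) (π / 2) := by
    intro θ
    simp only
    rw [show 2 * (θ + π / 2) = 2 * θ + π by ring, sin_add_pi, abs_neg]
  have h4 := hper.intervalIntegral_add_zsmul_eq 4 (-π) intervalIntegrable_log_one_add_abs_sin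
  rw [hper.intervalIntegral_add_eq (-π) 0] at h4
  have e : -π + (4 : ℤ) • (π / 2) = π := by
    rw [zsmul_eq_mul]; push_cast; ring
  rw [e, zero_add] at h4
  have hq : ∫ θ in (0 : ℝ)..π / 2, log (2 * (1 + |sin (2 * θ)|)) =
      ∫ θ in (0 : ℝ)..π / 2, 2 * log (2 * sin (θ + π / 4)) := by
    refine integral_congr fun θ hθ => ?_
    rw [uIcc_of_le (by positivity)] at hθ
    have hs : 0 ≤ sin (2 * θ) := sin_nonneg_of_nonneg_of_le_pi (by linarith [hθ.1]) (by linarith [hθ.2])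
    have e : 2 * (1 + |sin (2 * θ)|) = (2 * sin (θ + π / 4)) ^ 2 := by
      have h2 : √2 ^ 2 = 2 := sq_sqrt (by norm_num)
      rw [abs_of_nonneg hs, sin_add, sin_pi_div_four, cos_pi_div_four, sin_two_mul]
      linear_combination (-(sin θ + cos θ) ^ 2) * h2 - 2 * sin_sq_add_cos_sq θ
    rw [e, log_pow]
    norm_num
  have hl : ∫ t in π / 4..3 * π / 4, log (2 * sin t) = 2 * lob (π / 4) := by
    have h1 := integral_add_adjacent_intervals (intervalIntegrable_log_two_mul_sin 0 (π / 4))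
      (intervalIntegrable_log_two_mul_sin (π / 4) (3 * π / 4))
    have h2 := lob_pi_sub (π / 4)
    rw [show π - π / 4 = 3 * π / 4 by ring] at h2
    unfold lob at *
    linarith
  rw [h4, hq, intervalIntegral.integral_const_mul,
    integral_comp_add_right (fun t => log (2 * sin t)), zero_add,
    show π / 2 + π / 4 = 3 * π / 4 by ring, hl, zsmul_eq_mul]
  push_cast
  ring

theorem v8_eq : Quantum6j.v8 = 8 * lob (π / 4) := by
  have hii : IntervalIntegrable radialIntegral volume (-π) π :=
    ((intervalIntegrable_log_one_add_abs_sin _ _).sub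
      (intervalIntegrable_log_sin_two_mul _ _)).div_const 2
  have hint : ∫ θ in (-π)..π, radialIntegral θ = 8 * lob (π / 4) := by
    unfold radialIntegral
    rw [intervalIntegral.integral_div, intervalIntegral.integral_sub
      (intervalIntegrable_log_one_add_abs_sin _ _) (intervalIntegrable_log_sin_two_mul _ _),
      integral_log_one_add_abs_sin, integral_log_sin_two_mul]
    ring
  have hle : -π ≤ π := by linarith [pi_pos]
  rw [Quantum6j.v8, hyperbolicVolume_octahedron_eq_diamond, lintegral_diamond,
    ← ofReal_integral_eq_lintegral_ofReal, restrict_Ioo_eq_restrict_Ioc, ← integral_of_le hle,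
    hint, ENNReal.toReal_ofReal]
  · have := le_lob_pi_div_four
    norm_num at *
    linarith
  · exact (intervalIntegrable_iff_integrableOn_Ioo_of_le hle).1 hii
  · exact Filter.Eventually.of_forall radialIntegral_nonneg

/-! ### The main theorem -/

theorem mainTheorem2 :
    ∃ C : ℝ, ∀ r : ℕ, 3 ≤ r → Odd r →
      ∀ n₁ n₂ n₃ n₄ n₅ n₆ : ℕ, Quantum6j.Admissible r n₁ n₂ n₃ n₄ n₅ n₆ →
        2 * Real.pi / (r : ℝ) * Real.log ‖Quantum6j.sixJ r n₁ n₂ n₃ n₄ n₅ n₆‖ ≤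
          Quantum6j.v8 + C * (Real.log (r : ℝ) / (r : ℝ)) := by
  refine ⟨2018 * π, fun r hr3 hr n₁ n₂ n₃ n₄ n₅ n₆ h => ?_⟩
  rw [v8_eq]
  exact log_norm_sixJ_le hr3 hr h
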